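/- A total graph is a triple $(V_0,V_1,E)$ with $V_0\cap V_1=\emptyset$ and $E\subseteq\binom{V_0\cup V_1}{2}$; the vertices in $V_0$ are called empty and those in $V_1$ full. The total degree of a vertex $v$ is the number of edges in $E$ containing $v$, plus $1$ if $v\in V_1$. A total graph is locally irregular if the two ends of every edge have distinct total degrees. A total coloring of a finite simple graph $G$ assigns a color to every vertex and every edge of $G$. Each color $a$ induces a total graph: its edges are the edges of color $a$, its full vertices are the vertices of color $a$, and its empty vertices are the ends of edges of color $a$ that do not have color $a$ themselves. The coloring is a locally irregular total coloring if every color induces a locally irregular total graph, and $\operatorname{tlir}(G)$ denotes the minimum number of colors in a locally irregular total coloring of $G$. A graph is outerplanar if it has a crossing-free drawing in the plane in which every vertex lies on the boundary of the outer (unbounded) face. Theorem. Every finite simple outerplanar graph $G$ admits a locally irregular total coloring with at most three colors, that is, $\operatorname{tlir}(G)\le 3$. -/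

import Mathlib

namespace SimpleGraph

/-! ### Total graphs and locally irregular total colorings -/

/-- A total graph whose vertices lie in `V`: disjoint sets of empty and of full vertices, and a
set of edges (given as a simple graph on `V`) all of whose ends are empty or full vertices. -/
structure TotalGraph (V : Type*) where
  /-- the set of empty vertices -/
  emptyVerts : Set V
  /-- the set of full vertices -/
  fullVerts : Set V
  disjoint : Disjoint emptyVerts fullVerts
  /-- the edges -/
  edges : SimpleGraph V
  edge_vert : ∀ ⦃u v : V⦄, edges.Adj u v → u ∈ emptyVerts ∪ fullVerts

open Classical in
/-- The total degree of a vertex: the number of its edges, plus one if it is full. -/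
noncomputable def TotalGraph.totalDegree {V : Type*} (H : TotalGraph V) (v : V) : ℕ :=
  (H.edges.incidenceSet v).ncard + if v ∈ H.fullVerts then 1 else 0

/-- Adjacent vertices have distinct total degrees. -/
def TotalGraph.IsLocallyIrregular {V : Type*} (H : TotalGraph V) : Prop :=
  ∀ ⦃u v : V⦄, H.edges.Adj u v → H.totalDegree u ≠ H.totalDegree v

/-- A total coloring assigns a color to every vertex and to every edge. -/
structure TotalColoring {V : Type*} (G : SimpleGraph V) (K : Type*) where
  vertexColor : V → K
  edgeColor : G.EdgeLabeling K

/-- The total subgraph induced by the color `a`: its edges are the edges of color `a`, its full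
vertices are the vertices of color `a`, and its empty vertices are the ends of edges of color `a`
that do not themselves have color `a`. -/
def TotalColoring.colorClass {V : Type*} {G : SimpleGraph V} {K : Type*}
    (c : G.TotalColoring K) (a : K) : TotalGraph V where
  emptyVerts := {v | c.vertexColor v ≠ a ∧ ∃ w, (c.edgeColor.labelGraph a).Adj v w}
  fullVerts := {v | c.vertexColor v = a}
  disjoint := Set.disjoint_left.2 fun _ h h' => h.1 h'
  edges := c.edgeColor.labelGraph a
  edge_vert := fun u v h => by
    by_cases hu : c.vertexColor u = a
    · exact Or.inr hu
    · exact Or.inl ⟨hu, v, h⟩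

/-- A locally irregular total coloring: every color induces a locally irregular total graph. -/
def TotalColoring.IsTLIR {V : Type*} {G : SimpleGraph V} {K : Type*}
    (c : G.TotalColoring K) : Prop :=
  ∀ a : K, (c.colorClass a).IsLocallyIrregular

/-- The graph has a locally irregular total coloring with colors from a set of size `k`. -/
def TLIRColorable {V : Type*} (G : SimpleGraph V) (k : ℕ) : Prop :=
  ∃ c : G.TotalColoring (Fin k), c.IsTLIR

/-- The locally irregular total chromatic index: the least number of colors in a locally irregular
total coloring (`⊤` if there is none). -/
noncomputable def tlir {V : Type*} (G : SimpleGraph V) : ℕ∞ :=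
  ⨅ k ∈ {k : ℕ | G.TLIRColorable k}, (k : ℕ∞)

/-! ### Outerplanar graphs -/

/-- A drawing of `G` in the Euclidean plane without crossings: the vertices are distinct points,
every edge is a simple arc joining its two ends, and the interior of an arc contains no vertex and
no interior point of another arc. -/
structure PlaneDrawing {V : Type*} (G : SimpleGraph V) where
  point : V → EuclideanSpace ℝ (Fin 2)
  point_injective : Function.Injective point
  arc : G.edgeSet → unitInterval → EuclideanSpace ℝ (Fin 2)
  arc_continuous : ∀ e, Continuous (arc e)
  arc_injective : ∀ e, Function.Injective (arc e)
  arc_ends : ∀ e, s(arc e 0, arc e 1) = Sym2.map point (e : Sym2 V)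
  arc_ne_point : ∀ e, ∀ t ∈ Set.Ioo (0 : unitInterval) 1, ∀ v, arc e t ≠ point v
  arc_ne_arc : ∀ e f, e ≠ f → ∀ s ∈ Set.Ioo (0 : unitInterval) 1,
    ∀ t ∈ Set.Ioo (0 : unitInterval) 1, arc e s ≠ arc f t

/-- The set of all points of the plane that are used by the drawing. -/
def PlaneDrawing.carrier {V : Type*} {G : SimpleGraph V} (D : G.PlaneDrawing) :
    Set (EuclideanSpace ℝ (Fin 2)) :=
  Set.range D.point ∪ ⋃ e, Set.range (D.arc e)

/-- The faces are the connected components of the complement of the drawing. -/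
def PlaneDrawing.IsFace {V : Type*} {G : SimpleGraph V} (D : G.PlaneDrawing)
    (F : Set (EuclideanSpace ℝ (Fin 2))) : Prop :=
  ∃ x ∈ D.carrierᶜ, F = connectedComponentIn D.carrierᶜ x

/-- The outer face of a drawing of a finite graph is its unbounded face. -/
def PlaneDrawing.IsOuterFace {V : Type*} {G : SimpleGraph V} (D : G.PlaneDrawing)
    (F : Set (EuclideanSpace ℝ (Fin 2))) : Prop :=
  D.IsFace F ∧ ¬ Bornology.IsBounded F

/-- A graph is outerplanar if it has a drawing in the plane without crossings in which every vertex
lies on the boundary of the outer face. -/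
def IsOuterplanar {V : Type*} (G : SimpleGraph V) : Prop :=
  ∃ D : G.PlaneDrawing, ∃ F, D.IsOuterFace F ∧ ∀ v, D.point v ∈ frontier F

end SimpleGraph

/-! ### Logarithmic increments and crossing numbers of plane drawings -/

/-! Two facts carry the theorem: distance layers of an outerplanar graph induce disjoint paths, and
two colors nearly suffice for paths.

An extra point in the outer face can be joined to every vertex. So a `K₂,₃` or `K₄` minor would
produce a drawing of `K₃,₃` or `K₅` with nonadjacent edges disjoint, which a parity count of winding
numbers excludes (`not_planar_K33`, `not_planar_K5`). Three neighbors of a vertex on its own layer,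
or a cycle inside a layer, would give such a minor together with the root. Hence the edges inside
layers form disjoint paths (`IsOuterplanar.exists_pathLayering`).

The color `none` serves the edges between layers. Whether a vertex itself is colored `none` is
decided so that its total degree in that color has the parity of its level; this separates the ends
of each such edge. A vertex not colored `none` adds one unit of degree in one of the other two
colors, and that choice is free. A path can be colored with these two colors if it has an odd number
of vertices or at least one such free unit (`exists_path_coloring`).

For a remaining path, the edge from its first vertex `u` to the parent of `u` is recolored. This
edge is a free unit for the parent, whose path dictates its color. It pairs with the first path
edge, so that the path splits into monochromatic pairs of edges. It also changes the parity at `u`,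
so that `u` may leave `none`, and the color of `u` adjusts its degree to 2 or 3, whichever differs
from the degree of the parent. Recoloring affects only paths one level up, so the paths concerned
are determined from the deepest level upward (`PathLayering.exists_isHeadSet`). -/

theorem Complex.exists_continuous_exp_eq {A : Type*} [TopologicalSpace A] [SimplyConnectedSpace A]
    [LocallyPathConnectedSpace A] {f : A → ℂ} (hf : Continuous f) (h0 : ∀ a, f a ≠ 0) :
    ∃ g : A → ℂ, Continuous g ∧ ∀ a, Complex.exp (g a) = f a := by
  obtain ⟨a₀⟩ : Nonempty A := inferInstance
  obtain ⟨F, ⟨-, hF⟩, -⟩ := Complex.isCoveringMapOn_exp.existsUnique_continuousMap_lifts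
    (⟨f, hf⟩ : C(A, ℂ)) (a₀ := a₀) (e₀ := Complex.log (f a₀)) (Complex.exp_log (h0 a₀)) h0
  exact ⟨F, F.continuous, fun a => congrFun hF a⟩

/-- Two continuous logarithms of one function differ by a constant, by uniqueness of lifts along the
covering map `exp`. This makes `logIncrement` independent of the choice. -/
theorem Complex.lift_exp_sub_eq {f g g' : ℝ → ℂ} (hg : Continuous g) (hg' : Continuous g')
    (h : ∀ t, Complex.exp (g t) = f t) (h' : ∀ t, Complex.exp (g' t) = f t) (a b : ℝ) :
    g b - g a = g' b - g' a := by
  have hf : Continuous f := by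
    rw [show f = fun t => Complex.exp (g t) from funext fun t => (h t).symm]
    fun_prop
  have hs : ∀ t, f t ∈ ({0}ᶜ : Set ℂ) := fun t => by
    rw [← h t]; exact Complex.exp_ne_zero _
  have hshift : Complex.exp (g a - g' a) = 1 := by
    rw [Complex.exp_sub, h, h', div_self (hs a)]
  have hu := (Complex.isCoveringMapOn_exp.existsUnique_continuousMap_lifts
    (⟨f, hf⟩ : C(ℝ, ℂ)) (a₀ := a) (e₀ := g a) (h a) hs).unique
    (y₁ := ⟨g, hg⟩) (y₂ := ⟨fun t => g' t + (g a - g' a), by fun_prop⟩)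
    ⟨rfl, funext h⟩ ⟨by simp, funext fun t => by simp [Complex.exp_add, h', hshift]⟩
  have hb := DFunLike.congr_fun hu b
  simp only [ContinuousMap.coe_mk] at hb
  rw [hb]; ring

open Classical in
/-- The increment over `[0, 1]` of a continuous logarithm of `f`. -/
noncomputable def Complex.logIncrement (f : ℝ → ℂ) : ℂ :=
  if h : ∃ g : ℝ → ℂ, Continuous g ∧ ∀ t, Complex.exp (g t) = f t then h.choose 1 - h.choose 0
  else 0

theorem Complex.logIncrement_eq {f g : ℝ → ℂ} (hg : Continuous g)
    (h : ∀ t, Complex.exp (g t) = f t) : Complex.logIncrement f = g 1 - g 0 := by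
  have hex : ∃ g : ℝ → ℂ, Continuous g ∧ ∀ t, Complex.exp (g t) = f t := ⟨g, hg, h⟩
  rw [Complex.logIncrement, dif_pos hex]
  exact Complex.lift_exp_sub_eq hex.choose_spec.1 hg hex.choose_spec.2 h 0 1

theorem Complex.logIncrement_neg {f : ℝ → ℂ} (hf : Continuous f) (h0 : ∀ t, f t ≠ 0) :
    Complex.logIncrement (fun t => -f t) = Complex.logIncrement f := by
  obtain ⟨g, hg, h⟩ := Complex.exists_continuous_exp_eq hf h0
  rw [Complex.logIncrement_eq hg h,
    Complex.logIncrement_eq (g := fun t => g t + Real.pi * Complex.I) (by fun_prop)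
      (fun t => by rw [Complex.exp_add, Complex.exp_pi_mul_I, h]; ring)]
  ring

/-- The square is simply connected, so one logarithm serves all four sides and the total increment
around the boundary vanishes. -/
theorem Complex.logIncrement_square {f : ℝ × ℝ → ℂ} (hf : Continuous f) (h0 : ∀ a, f a ≠ 0) :
    Complex.logIncrement (fun s => f (s, 0)) + Complex.logIncrement (fun t => f (1, t)) =
      Complex.logIncrement (fun s => f (s, 1)) + Complex.logIncrement (fun t => f (0, t)) := by
  obtain ⟨g, hg, h⟩ := Complex.exists_continuous_exp_eq hf h0
  rw [Complex.logIncrement_eq (g := fun s => g (s, 0)) (by fun_prop) (fun _ => h _),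
    Complex.logIncrement_eq (g := fun s => g (s, 1)) (by fun_prop) (fun _ => h _),
    Complex.logIncrement_eq (g := fun s => g (1, s)) (by fun_prop) (fun _ => h _),
    Complex.logIncrement_eq (g := fun s => g (0, s)) (by fun_prop) (fun _ => h _)]
  ring

theorem Complex.exists_int_logIncrement {f : ℝ → ℂ} (hf : Continuous f) (h0 : ∀ t, f t ≠ 0)
    {x y : ℂ} (hx : Complex.exp x = f 0) (hy : Complex.exp y = f 1) :
    ∃ n : ℤ, Complex.logIncrement f = y - x + n * (2 * Real.pi * Complex.I) := by
  obtain ⟨g, hg, h⟩ := Complex.exists_continuous_exp_eq hf h0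
  rw [Complex.logIncrement_eq hg h]
  obtain ⟨m, hm⟩ := Complex.exp_eq_exp_iff_exists_int.1 ((h 0).trans hx.symm)
  obtain ⟨n, hn⟩ := Complex.exp_eq_exp_iff_exists_int.1 ((h 1).trans hy.symm)
  exact ⟨n - m, by rw [hm, hn]; push_cast; ring⟩

/-- The sign of an ordered pair of indices. -/
def pairSign {n : ℕ} (a b : Fin n) : ℤ := if b < a then 1 else -1

/-- Integers attached to a point and an arc of a plane drawing (winding of the arc as seen from the
point), satisfying one relation for each pair of disjoint arcs. -/
theorem exists_winding_of_disjoint {n : ℕ} {p : Fin n → ℂ} (hp : Function.Injective p)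
    {H : Fin n → Fin n → Prop} {E : Fin n → Fin n → Set ℂ}
    (hE : ∀ i j, H i j → JoinedIn (E i j) (p i) (p j)) :
    ∃ N : Fin n → Fin n → Fin n → ℤ, ∀ i j k l, H i j → H k l → Disjoint (E i j) (E k l) →
      2 * (N k i j + N j k l - N l i j - N i k l) +
        (pairSign k j + pairSign i k + pairSign j l + pairSign l i) = 0 := by
  classical
  let γ : ∀ i j, H i j → Path (p i) (p j) := fun i j h => (hE i j h).somePath
  have hγ : ∀ i j h (t : ℝ), (γ i j h).extend t ∈ E i j := fun i j h t => by
    rw [show (γ i j h).extend t = (γ i j h) (Set.projIcc 0 1 zero_le_one t) from rfl]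
    exact (hE i j h).somePath_mem _
  -- A fixed logarithm of `p w - p u`, normalized so that exchanging `u` and `w` changes it by
  -- exactly `±πi`. These signs are the source of the parity obstruction.
  let α : Fin n → Fin n → ℂ := fun u w =>
    if u < w then Complex.log (p w - p u) else Complex.log (p u - p w) + Real.pi * Complex.I
  have hα : ∀ u w, u ≠ w → Complex.exp (α u w) = p w - p u := by
    intro u w huw
    by_cases h : u < w
    · simp only [α, if_pos h]
      exact Complex.exp_log (sub_ne_zero.2 (hp.ne huw.symm))
    · simp only [α, if_neg h]
      rw [Complex.exp_add, Complex.exp_pi_mul_I, Complex.exp_log (sub_ne_zero.2 (hp.ne huw))]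
      ring
  have hαs : ∀ u w, u ≠ w → α u w - α w u = pairSign u w * (Real.pi * Complex.I) := by
    intro u w huw
    rcases lt_or_gt_of_ne huw with h | h
    · simp [α, pairSign, h, h.not_gt]
    · simp [α, pairSign, h, h.not_gt]
  let θ : ∀ (v i j : Fin n), H i j → ℂ := fun v i j h =>
    Complex.logIncrement (fun t => (γ i j h).extend t - p v)
  have hθ : ∀ v i j, ∃ m : ℤ, ∀ h : H i j, p v ∉ E i j →
      θ v i j h = α v j - α v i + m * (2 * Real.pi * Complex.I) := by
    intro v i j
    by_cases hh : H i j ∧ p v ∉ E i j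
    · obtain ⟨h, hv⟩ := hh
      have hvi : v ≠ i := fun e => hv (e ▸ (hE i j h).source_mem)
      have hvj : v ≠ j := fun e => hv (e ▸ (hE i j h).target_mem)
      obtain ⟨m, hm⟩ := Complex.exists_int_logIncrement
        (f := fun t => (γ i j h).extend t - p v) (by fun_prop)
        (fun t e => hv (by rw [← sub_eq_zero.1 e]; exact hγ i j h t))
        (x := α v i) (y := α v j) (by rw [hα v i hvi]; simp) (by rw [hα v j hvj]; simp)
      exact ⟨m, fun _ _ => hm⟩
    · exact ⟨0, fun h hv => absurd ⟨h, hv⟩ hh⟩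
  choose N hN using hθ
  refine ⟨N, fun i j k l hij hkl hd => ?_⟩
  have hd' := Set.disjoint_left.1 hd
  have hi := (hE i j hij).source_mem
  have hj := (hE i j hij).target_mem
  have hk := (hE k l hkl).source_mem
  have hl := (hE k l hkl).target_mem
  -- The arcs are disjoint, so the difference of their points does not vanish on the parameter
  -- square. On each side of the square one arc stays at an end point, so the four increments are
  -- windings of an arc about a vertex, up to a sign of the function.
  have hsq := Complex.logIncrement_square
    (f := fun a => (γ i j hij).extend a.1 - (γ k l hkl).extend a.2) (by fun_prop)
    (fun a e => hd' (hγ i j hij a.1) (by rw [sub_eq_zero.1 e]; exact hγ k l hkl a.2))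
  have e1 := Complex.logIncrement_neg
    (f := fun t => (γ k l hkl).extend t - p j) (by fun_prop)
    (fun t e => hd' hj (by rw [← sub_eq_zero.1 e]; exact hγ k l hkl t))
  have e0 := Complex.logIncrement_neg
    (f := fun t => (γ k l hkl).extend t - p i) (by fun_prop)
    (fun t e => hd' hi (by rw [← sub_eq_zero.1 e]; exact hγ k l hkl t))
  simp only [neg_sub] at e0 e1
  simp only [Path.extend_zero, Path.extend_one, e0, e1] at hsq
  have h1 := hN k i j hij (fun h => hd' h hk)
  have h2 := hN l i j hij (fun h => hd' h hl)
  have h3 := hN j k l hkl (fun h => hd' hj h)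
  have h4 := hN i k l hkl (fun h => hd' hi h)
  have nkj := hαs k j (fun e => hd' hj (e ▸ hk))
  have nik := hαs i k (fun e => hd' hi (e ▸ hk))
  have njl := hαs j l (fun e => hd' hj (e ▸ hl))
  have nli := hαs l i (fun e => hd' hi (e ▸ hl))
  simp only [θ] at h1 h2 h3 h4
  rw [h1, h2, h3, h4] at hsq
  have hpi : (Real.pi : ℂ) * Complex.I ≠ 0 :=
    mul_ne_zero (by exact_mod_cast Real.pi_ne_zero) Complex.I_ne_zero
  have key : ((2 * (N k i j + N j k l - N l i j - N i k l) +
        (pairSign k j + pairSign i k + pairSign j l + pairSign l i) : ℤ) : ℂ) *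
        (Real.pi * Complex.I) = 0 := by
    push_cast
    linear_combination hsq - nkj - nik - njl - nli
  exact_mod_cast (mul_eq_zero.1 key).resolve_right hpi

/-- The complete bipartite graph `K₃,₃` cannot be drawn in the plane so that nonadjacent edges are
disjoint. -/
theorem not_planar_K33 {a b : Fin 3 → ℂ} {E : Fin 3 → Fin 3 → Set ℂ}
    (hE : ∀ i j, JoinedIn (E i j) (a i) (b j))
    (hd : ∀ i j k l, i ≠ k → j ≠ l → Disjoint (E i j) (E k l)) : False := by
  have other : ∀ i : Fin 3, ∃ k, i ≠ k := by decide
  have haa : ∀ i k, a i = a k → i = k := fun i k e => by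
    by_contra hik
    exact Set.disjoint_left.1 (hd i 0 k 1 hik (by decide)) (hE i 0).source_mem
      (e ▸ (hE k 1).source_mem)
  have hbb : ∀ j l, b j = b l → j = l := fun j l e => by
    by_contra hjl
    exact Set.disjoint_left.1 (hd 0 j 1 l (by decide) hjl) (hE 0 j).target_mem
      (e ▸ (hE 1 l).target_mem)
  have hab : ∀ i j, a i ≠ b j := fun i j e => by
    obtain ⟨k, hk⟩ := other i
    obtain ⟨l, hl⟩ := other j
    exact Set.disjoint_left.1 (hd i l k j hk hl.symm) (hE i l).source_mem
      (e ▸ (hE k j).target_mem)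
  let c : Fin 6 → Fin 3 := ![0, 1, 2, 0, 1, 2]
  have hc : ∀ i k : Fin 6, i < 3 → k < 3 → c i = c k → i = k := by decide
  have hc' : ∀ i k : Fin 6, ¬ i < 3 → ¬ k < 3 → c i = c k → i = k := by decide
  let p : Fin 6 → ℂ := fun i => if i < 3 then a (c i) else b (c i)
  have hp : Function.Injective p := by
    intro i k e
    by_cases hi : i < 3 <;> by_cases hk : k < 3 <;> simp only [p, hi, hk, if_true, if_false] at e
    · exact hc i k hi hk (haa _ _ e)
    · exact absurd e (hab _ _)
    · exact absurd e.symm (hab _ _)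
    · exact hc' i k hi hk (hbb _ _ e)
  obtain ⟨N, hN⟩ := exists_winding_of_disjoint hp (H := fun i j => i < 3 ∧ ¬ j < 3)
    (E := fun i j => E (c i) (c j))
    (fun i j h => by simpa only [p, h.1, h.2, if_true, if_false] using hE (c i) (c j))
  have key : ∀ i j k l : Fin 6, i < 3 → k < 3 → ¬ j < 3 → ¬ l < 3 → i ≠ k → j ≠ l → _ :=
    fun i j k l hi hk hj hl hik hjl =>
      hN i j k l ⟨hi, hj⟩ ⟨hk, hl⟩
        (hd _ _ _ _ (fun h => hik (hc i k hi hk h)) (fun h => hjl (hc' j l hj hl h)))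
  have h01 := fun j l => key 0 j 1 l (by decide) (by decide)
  have h02 := fun j l => key 0 j 2 l (by decide) (by decide)
  have h12 := fun j l => key 1 j 2 l (by decide) (by decide)
  have s : ∀ a b : Fin 6, pairSign a b = if b < a then 1 else -1 := fun _ _ => rfl
  have a1 := h01 3 4; have a2 := h01 3 5; have a3 := h01 4 5
  have a4 := h01 4 3; have a5 := h01 5 3; have a6 := h01 5 4
  have b1 := h02 3 4; have b2 := h02 3 5; have b3 := h02 4 5
  have b4 := h02 4 3; have b5 := h02 5 3; have b6 := h02 5 4
  have c1 := h12 3 4; have c2 := h12 3 5; have c3 := h12 4 5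
  have c4 := h12 4 3; have c5 := h12 5 3; have c6 := h12 5 4
  clear h01 h02 h12 key hN
  simp +decide only [s, if_true, if_false, forall_const] at a1 a2 a3 a4 a5 a6 b1 b2 b3 b4 b5 b6 c1 c2 c3 c4 c5 c6
  -- Each integer `N v i j` occurs in exactly two of the 18 relations, with coefficients `±2`, so
  -- the sum of its terms is divisible by 4. The signs add up to `-2` for each of the 9 pairs of
  -- edges that interlace in the order of the indices and to 0 otherwise. The total is 2 modulo 4,
  -- which is impossible.
  omega

/-- The complete graph `K₅` cannot be drawn in the plane so that nonadjacent edges are disjoint. -/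
theorem not_planar_K5 {p : Fin 5 → ℂ} (hp : Function.Injective p)
    {E : Fin 5 → Fin 5 → Set ℂ}
    (hE : ∀ i j, i < j → JoinedIn (E i j) (p i) (p j))
    (hd : ∀ i j k l, i < j → k < l → i ≠ k → i ≠ l → j ≠ k → j ≠ l →
      Disjoint (E i j) (E k l)) : False := by
  obtain ⟨N, hN⟩ := exists_winding_of_disjoint hp (H := fun i j => i < j) (E := E) hE
  have key : ∀ i j k l : Fin 5, i < j → k < l → i ≠ k → i ≠ l → j ≠ k → j ≠ l → _ :=
    fun i j k l hi hk h1 h2 h3 h4 =>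
      hN i j k l hi hk (hd i j k l hi hk h1 h2 h3 h4)
  have s : ∀ a b : Fin 5, pairSign a b = if b < a then 1 else -1 := fun _ _ => rfl
  have a1 := key 0 1 2 3; have a2 := key 0 2 1 3; have a3 := key 0 3 1 2
  have b1 := key 0 1 2 4; have b2 := key 0 2 1 4; have b3 := key 0 4 1 2
  have c1 := key 0 1 3 4; have c2 := key 0 3 1 4; have c3 := key 0 4 1 3
  have d1 := key 0 2 3 4; have d2 := key 0 3 2 4; have d3 := key 0 4 2 3
  have e1 := key 1 2 3 4; have e2 := key 1 3 2 4; have e3 := key 1 4 2 3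
  clear key hN
  simp +decide only [s, if_true, if_false, forall_const] at a1 a2 a3 b1 b2 b3 c1 c2 c3 d1 d2 d3 e1 e2 e3
  -- The same count: every winding number occurs twice, while the 5 interlaced pairs, one for each
  -- four vertices, contribute `-10`, which is 2 modulo 4.
  omega

namespace SimpleGraph

/-! ### Subdrawings and the apex in the outer face -/

namespace PlaneDrawing

variable {V : Type*} {G : SimpleGraph V}

/-- The part of a drawing spanned by a set of vertices. -/
def region (D : G.PlaneDrawing) (S : Set V) : Set (EuclideanSpace ℝ (Fin 2)) :=
  {x | (∃ v ∈ S, x = D.point v) ∨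
    ∃ e : G.edgeSet, (∀ v ∈ (e : Sym2 V), v ∈ S) ∧ ∃ t, x = D.arc e t}

theorem region_mono (D : G.PlaneDrawing) {S T : Set V} (h : S ⊆ T) : D.region S ⊆ D.region T := by
  rintro x (⟨v, hv, rfl⟩ | ⟨e, he, t, rfl⟩)
  · exact Or.inl ⟨v, h hv, rfl⟩
  · exact Or.inr ⟨e, fun v hv => h (he v hv), t, rfl⟩

theorem region_subset_carrier (D : G.PlaneDrawing) (S : Set V) : D.region S ⊆ D.carrier := by
  rintro x (⟨v, hv, rfl⟩ | ⟨e, he, t, rfl⟩)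
  · exact Or.inl ⟨v, rfl⟩
  · exact Or.inr (Set.mem_iUnion.2 ⟨e, t, rfl⟩)

theorem isClosed_region [Finite V] (D : G.PlaneDrawing) (S : Set V) : IsClosed (D.region S) := by
  have : D.region S = D.point '' S ∪
      ⋃ e ∈ {e : G.edgeSet | ∀ v ∈ (e : Sym2 V), v ∈ S}, Set.range (D.arc e) := by
    ext x
    simp only [region, Set.mem_ofPred_eq, Set.mem_union, Set.mem_image, Set.mem_iUnion,
      Set.mem_range, exists_prop, eq_comm]
  rw [this]
  exact ((Set.toFinite S).image _).isClosed.union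
    ((Set.toFinite _).isClosed_biUnion fun e _ => (isCompact_range (D.arc_continuous e)).isClosed)

theorem arc_end_eq_point (D : G.PlaneDrawing) (e : G.edgeSet) {t : unitInterval}
    (ht : t ∉ Set.Ioo (0 : unitInterval) 1) : ∃ v ∈ (e : Sym2 V), D.arc e t = D.point v := by
  have h : t = 0 ∨ t = 1 := by
    by_contra hh
    push Not at hh
    exact ht ⟨lt_of_le_of_ne unitInterval.nonneg' (Ne.symm hh.1),
      lt_of_le_of_ne unitInterval.le_one' hh.2⟩
  have hm : D.arc e t ∈ Sym2.map D.point (e : Sym2 V) := by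
    rw [← D.arc_ends e]
    rcases h with rfl | rfl <;> simp
  obtain ⟨v, hv, hv'⟩ := Sym2.mem_map.1 hm
  exact ⟨v, hv, hv'.symm⟩

theorem mem_region_cases (D : G.PlaneDrawing) {S : Set V} {x : EuclideanSpace ℝ (Fin 2)}
    (hx : x ∈ D.region S) : (∃ v ∈ S, x = D.point v) ∨
      ∃ e : G.edgeSet, (∀ v ∈ (e : Sym2 V), v ∈ S) ∧
        ∃ t ∈ Set.Ioo (0 : unitInterval) 1, x = D.arc e t := by
  rcases hx with h | ⟨e, he, t, rfl⟩
  · exact Or.inl h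
  · by_cases ht : t ∈ Set.Ioo (0 : unitInterval) 1
    · exact Or.inr ⟨e, he, t, ht, rfl⟩
    · obtain ⟨v, hv, h⟩ := D.arc_end_eq_point e ht
      exact Or.inl ⟨v, he v hv, h⟩

/-- Points shared by two subdrawings can only be common vertices or lie on common edges, because a
plane drawing has no crossings. -/
theorem disjoint_region (D : G.PlaneDrawing) {S T : Set V} (h : Disjoint S T) :
    Disjoint (D.region S) (D.region T) := by
  rw [Set.disjoint_left] at h ⊢
  intro x hS hT
  rcases D.mem_region_cases hS with ⟨v, hv, rfl⟩ | ⟨e, he, s, hs, rfl⟩ <;>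
    rcases D.mem_region_cases hT with ⟨w, hw, e1⟩ | ⟨f, hf, t, ht, e1⟩
  · exact h hv (D.point_injective e1 ▸ hw)
  · exact D.arc_ne_point f t ht v e1.symm
  · exact D.arc_ne_point e s hs w e1
  · refine D.arc_ne_arc e f ?_ s hs t ht e1
    rintro rfl
    obtain ⟨e, he'⟩ := e
    induction e with
    | _ u v => exact h (he u (by simp)) (hf u (by simp))

theorem point_mem_region_iff (D : G.PlaneDrawing) {S : Set V} {v : V} :
    D.point v ∈ D.region S ↔ v ∈ S := by
  refine ⟨fun h => ?_, fun h => Or.inl ⟨v, h, rfl⟩⟩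
  rcases D.mem_region_cases h with ⟨w, hw, e⟩ | ⟨e, -, t, ht, h⟩
  · exact D.point_injective e ▸ hw
  · exact absurd h.symm (D.arc_ne_point e t ht v)

theorem joinedIn_region_of_adj (D : G.PlaneDrawing) {S : Set V} {u v : V} (h : G.Adj u v)
    (hu : u ∈ S) (hv : v ∈ S) : JoinedIn (D.region S) (D.point u) (D.point v) := by
  let e : G.edgeSet := ⟨s(u, v), h⟩
  have hj : JoinedIn (D.region S) (D.arc e 0) (D.arc e 1) :=
    ⟨⟨⟨D.arc e, D.arc_continuous e⟩, rfl, rfl⟩, fun t => Or.inr ⟨e, by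
      intro w hw
      rcases Sym2.mem_iff.1 hw with rfl | rfl <;> assumption, t, rfl⟩⟩
  have he : s(D.arc e 0, D.arc e 1) = s(D.point u, D.point v) := D.arc_ends e
  rcases Sym2.eq_iff.1 he with ⟨h0, h1⟩ | ⟨h0, h1⟩
  · rwa [h0, h1] at hj
  · rw [h0, h1] at hj
    exact hj.symm

theorem joinedIn_region_of_walk (D : G.PlaneDrawing) {S : Set V} {u v : V} (p : G.Walk u v)
    (hp : ∀ w ∈ p.support, w ∈ S) : JoinedIn (D.region S) (D.point u) (D.point v) := by
  induction p with
  | nil => exact JoinedIn.refl (D.point_mem_region_iff.2 (hp _ (by simp)))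
  | cons h p ih =>
    have h1 := D.joinedIn_region_of_adj h (hp _ (by simp))
      (hp _ (by rw [Walk.support_cons]; exact List.mem_cons_of_mem _ p.start_mem_support))
    exact h1.trans (ih fun w hw => hp w (by rw [Walk.support_cons]; exact List.mem_cons_of_mem _ hw))

theorem carrier_eq_region (D : G.PlaneDrawing) : D.carrier = D.region Set.univ := by
  refine Set.Subset.antisymm ?_ (D.region_subset_carrier _)
  rintro x (⟨v, rfl⟩ | h)
  · exact Or.inl ⟨v, trivial, rfl⟩
  · obtain ⟨e, t, rfl⟩ := Set.mem_iUnion.1 h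
    exact Or.inr ⟨e, fun _ _ => trivial, t, rfl⟩

/-- If all vertices are on the boundary of one face then a point of that face can be joined to
each vertex without meeting the part of the drawing that avoids the vertex. -/
theorem exists_apex [Finite V] (D : G.PlaneDrawing) {F : Set (EuclideanSpace ℝ (Fin 2))}
    (hF : D.IsFace F) (hv : ∀ v, D.point v ∈ frontier F) :
    ∃ x ∉ D.carrier, ∃ X : V → Set (EuclideanSpace ℝ (Fin 2)),
      ∀ v, JoinedIn (X v) x (D.point v) ∧ ∀ T : Set V, v ∉ T → Disjoint (X v) (D.region T) := by
  obtain ⟨x, hx, rfl⟩ := hF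
  set F := connectedComponentIn D.carrierᶜ x with hFdef
  have hcar : IsOpen D.carrierᶜ := by
    rw [carrier_eq_region]; exact (D.isClosed_region _).isOpen_compl
  have hFo : IsOpen F := hcar.connectedComponentIn
  have hFc : IsConnected F := isConnected_connectedComponentIn_iff.2 hx
  have hFp : IsPathConnected F := hFo.isConnected_iff_isPathConnected.1 hFc
  have hFs : F ⊆ D.carrierᶜ := connectedComponentIn_subset _ _
  have hxF : x ∈ F := mem_connectedComponentIn hx
  refine ⟨x, hx, ?_⟩
  have hball : ∀ v, ∃ r > 0, Metric.ball (D.point v) r ⊆ (D.region {v}ᶜ)ᶜ := fun v =>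
    Metric.isOpen_iff.1 (D.isClosed_region _).isOpen_compl _
      (fun h => D.point_mem_region_iff.1 h rfl)
  choose r hr hball using hball
  -- Travel inside the face to a point near `v`, then straight to `v` in a ball that misses
  -- everything drawn without `v`. These sets overlap for different `v`, which is harmless since
  -- edges at the apex are adjacent.
  refine ⟨fun v => F ∪ Metric.ball (D.point v) (r v), fun v => ⟨?_, fun T hT => ?_⟩⟩
  · obtain ⟨q, hqb, hqF⟩ := Metric.mem_closure_iff.1 (frontier_subset_closure (hv v)) (r v) (hr v)
    have h1 : JoinedIn F x q := hFp.joinedIn x hxF q hqb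
    have h2 : JoinedIn (Metric.ball (D.point v) (r v)) q (D.point v) :=
      ((convex_ball (D.point v) (r v)).isPathConnected ⟨_, Metric.mem_ball_self (hr v)⟩).joinedIn
        q (by rwa [Metric.mem_ball, _root_.dist_comm]) _ (Metric.mem_ball_self (hr v))
    exact (h1.mono Set.subset_union_left).trans (h2.mono Set.subset_union_right)
  · have hT' : T ⊆ {v}ᶜ := fun w hw e => hT (by rwa [← Set.mem_singleton_iff.1 e])
    rw [Set.disjoint_left]
    rintro y (hy | hy) hyT
    · exact hFs hy (D.region_subset_carrier _ hyT)
    · exact hball v hy (D.region_mono hT' hyT)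

end PlaneDrawing

/-! ### Excluded minors of outerplanar graphs -/

theorem joinedIn_complex {S : Set (EuclideanSpace ℝ (Fin 2))} {x y : EuclideanSpace ℝ (Fin 2)}
    (h : JoinedIn S x y) :
    JoinedIn (Complex.orthonormalBasisOneI.repr.symm '' S)
      (Complex.orthonormalBasisOneI.repr.symm x) (Complex.orthonormalBasisOneI.repr.symm y) :=
  ⟨h.somePath.map Complex.orthonormalBasisOneI.repr.symm.continuous,
    fun t => ⟨_, h.somePath_mem t, rfl⟩⟩

/-- An outerplanar graph has no minor `K₂,₃`. -/
theorem IsOuterplanar.not_K23 {V : Type*} [Finite V] {G : SimpleGraph V} (hG : G.IsOuterplanar)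
    {a b : V} {p : Fin 3 → V} {A B : Fin 3 → Set V}
    (hA : ∀ i, ∃ w : G.Walk a (p i), ∀ u ∈ w.support, u ∈ A i)
    (hB : ∀ i, ∃ w : G.Walk b (p i), ∀ u ∈ w.support, u ∈ B i)
    (hd : ∀ i j, i ≠ j → Disjoint (A i) (B j)) : False := by
  obtain ⟨D, F, hF, hv⟩ := hG
  obtain ⟨x, hx, X, hX⟩ := D.exists_apex hF.1 hv
  have hpA : ∀ i, p i ∈ A i := fun i => (hA i).elim fun w hw => hw _ w.end_mem_support
  have hpB : ∀ i, p i ∈ B i := fun i => (hB i).elim fun w hw => hw _ w.end_mem_support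
  have hAB : ∀ i j, i ≠ j → p i ∉ A j := fun i j h h' =>
    Set.disjoint_left.1 (hd j i h.symm) h' (hpB i)
  have hBA : ∀ i j, i ≠ j → p i ∉ B j := fun i j h h' =>
    Set.disjoint_left.1 (hd i j h) (hpA i) h'
  let E : Fin 3 → Fin 3 → Set (EuclideanSpace ℝ (Fin 2)) := fun i j =>
    ![D.region (A j), D.region (B j), X (p j)] i
  let φ := Complex.orthonormalBasisOneI.repr.symm
  refine not_planar_K33 (a := fun i => φ (![D.point a, D.point b, x] i))
    (b := fun j => φ (D.point (p j))) (E := fun i j => φ '' E i j) ?_ ?_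
  · intro i j
    apply joinedIn_complex
    fin_cases i
    · obtain ⟨w, hw⟩ := hA j
      exact D.joinedIn_region_of_walk w hw
    · obtain ⟨w, hw⟩ := hB j
      exact D.joinedIn_region_of_walk w hw
    · exact (hX (p j)).1
  · intro i j k l hik hjl
    rw [Set.disjoint_image_iff φ.injective]
    have h01 : ∀ j l, j ≠ l → Disjoint (D.region (A j)) (D.region (B l)) := fun j l h =>
      D.disjoint_region (hd j l h)
    have h20 : ∀ j l, j ≠ l → Disjoint (X (p j)) (D.region (A l)) := fun j l h =>
      (hX (p j)).2 _ (hAB j l h)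
    have h21 : ∀ j l, j ≠ l → Disjoint (X (p j)) (D.region (B l)) := fun j l h =>
      (hX (p j)).2 _ (hBA j l h)
    fin_cases i <;> fin_cases k <;> first | exact absurd rfl hik | skip
    · exact h01 j l hjl
    · exact (h20 l j hjl.symm).symm
    · exact (h01 l j hjl.symm).symm
    · exact (h21 l j hjl.symm).symm
    · exact h20 j l hjl
    · exact h21 j l hjl

/-- An outerplanar graph has no minor `K₄`. -/
theorem IsOuterplanar.not_K4 {V : Type*} [Finite V] {G : SimpleGraph V} (hG : G.IsOuterplanar)
    {p : Fin 4 → V} (hp : Function.Injective p) {A : Fin 4 → Fin 4 → Set V}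
    (hA : ∀ i j, i < j → ∃ w : G.Walk (p i) (p j), ∀ u ∈ w.support, u ∈ A i j)
    (hpA : ∀ i j k, j < k → i ≠ j → i ≠ k → p i ∉ A j k)
    (hd : ∀ i j k l, i < j → k < l → i ≠ k → i ≠ l → j ≠ k → j ≠ l → Disjoint (A i j) (A k l)) :
    False := by
  obtain ⟨D, F, hF, hv⟩ := hG
  obtain ⟨x, hx, X, hX⟩ := D.exists_apex hF.1 hv
  let E : Fin 5 → Fin 5 → Set (EuclideanSpace ℝ (Fin 2)) := fun i j =>
    Fin.cases (motive := fun _ => Set (EuclideanSpace ℝ (Fin 2))) ∅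
      (fun j => Fin.cases (motive := fun _ => Set (EuclideanSpace ℝ (Fin 2))) (X (p j))
        (fun i => D.region (A i j)) i) j
  let φ := Complex.orthonormalBasisOneI.repr.symm
  have hinj : Function.Injective (Fin.cons x fun i => D.point (p i) :
      Fin 5 → EuclideanSpace ℝ (Fin 2)) := by
    rw [Fin.cons_injective_iff]
    refine ⟨?_, D.point_injective.comp hp⟩
    rintro ⟨i, hi⟩
    exact hx (hi ▸ Or.inl ⟨_, rfl⟩)
  refine not_planar_K5 (φ.injective.comp hinj) (E := fun i j => φ '' E i j) ?_ ?_
  · intro i j hij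
    apply joinedIn_complex
    induction j using Fin.cases with
    | zero => exact absurd hij (Fin.not_lt_zero _)
    | succ j =>
      induction i using Fin.cases with
      | zero => exact (hX (p j)).1
      | succ i =>
        obtain ⟨w, hw⟩ := hA i j (Fin.succ_lt_succ_iff.1 hij)
        exact D.joinedIn_region_of_walk w hw
  · intro i j k l hij hkl hik hil hjk hjl
    rw [Set.disjoint_image_iff φ.injective]
    induction j using Fin.cases with
    | zero => exact absurd hij (Fin.not_lt_zero _)
    | succ j =>
    induction l using Fin.cases with
    | zero => exact absurd hkl (Fin.not_lt_zero _)
    | succ l =>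
    rw [Ne, Fin.succ_inj] at hjl
    induction i using Fin.cases with
    | zero =>
      induction k using Fin.cases with
      | zero => exact absurd rfl hik
      | succ k =>
        rw [Ne, Fin.succ_inj] at hjk
        exact (hX (p j)).2 _ (hpA j k l (Fin.succ_lt_succ_iff.1 hkl) hjk hjl)
    | succ i =>
      rw [Ne, Fin.succ_inj] at hil
      induction k using Fin.cases with
      | zero =>
        exact ((hX (p l)).2 _ (hpA l i j (Fin.succ_lt_succ_iff.1 hij) (Ne.symm hil)
          (Ne.symm hjl))).symm
      | succ k =>
        rw [Ne, Fin.succ_inj] at hik hjk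
        exact D.disjoint_region (hd i j k l (Fin.succ_lt_succ_iff.1 hij)
          (Fin.succ_lt_succ_iff.1 hkl) hik hil hjk hjl)

end SimpleGraph

namespace SimpleGraph

/-! ### Distance layers of an outerplanar graph -/

section Layers

variable {V : Type*}

theorem exists_adj_dist_eq {G : SimpleGraph V} {r v : V} {n : ℕ} (h : G.dist r v = n + 1) :
    ∃ p, G.Adj p v ∧ G.dist r p = n := by
  have hr : G.Reachable r v := Reachable.of_dist_ne_zero (by omega)
  obtain ⟨w, hw⟩ := hr.exists_walk_length_eq_dist
  have hn : ¬ w.Nil := by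
    intro hnil
    have := Walk.length_eq_zero_iff.2 hnil
    omega
  have hadj := w.adj_penultimate hn
  refine ⟨w.penultimate, hadj, ?_⟩
  have h1 : G.dist r w.penultimate ≤ n := by
    refine (dist_le w.dropLast).trans ?_
    rw [Walk.length_dropLast]
    omega
  have := hadj.diff_dist_adj (u := r)
  omega

variable (G : SimpleGraph V)

/-- A chosen vertex in the connected component of a vertex. -/
noncomputable def root (v : V) : V := (G.connectedComponentMk v).out

/-- The distance from the chosen root of the connected component. -/
noncomputable def level (v : V) : ℕ := G.dist (G.root v) v

/-- The edges that join two vertices of the same level. -/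
def layerGraph : SimpleGraph V where
  Adj u v := G.Adj u v ∧ G.level u = G.level v
  symm := ⟨fun _ _ h => ⟨h.1.symm, h.2.symm⟩⟩
  loopless := ⟨fun _ h => h.1.ne rfl⟩

variable {G}

theorem root_reachable (v : V) : G.Reachable (G.root v) v :=
  ConnectedComponent.exact (Quot.out_eq (G.connectedComponentMk v))

theorem root_eq_of_reachable {u v : V} (h : G.Reachable u v) : G.root u = G.root v := by
  unfold root
  rw [ConnectedComponent.sound h]

theorem root_root (v : V) : G.root (G.root v) = G.root v :=
  root_eq_of_reachable (root_reachable v)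

theorem level_root (v : V) : G.level (G.root v) = 0 := by
  rw [level, root_root, dist_self]

theorem eq_root_of_level_eq_zero {v : V} (h : G.level v = 0) : v = G.root v :=
  ((root_reachable v).dist_eq_zero_iff.1 h).symm

theorem level_of_adj {u v : V} (h : G.Adj u v) :
    G.level u = G.level v ∨ G.level u + 1 = G.level v ∨ G.level v + 1 = G.level u := by
  unfold level
  rw [root_eq_of_reachable h.reachable]
  have h1 := h.diff_dist_adj (u := G.root v)
  omega

theorem exists_parent {v : V} {n : ℕ} (h : G.level v = n + 1) :
    ∃ p, G.Adj p v ∧ G.level p = n := by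
  obtain ⟨p, hp, hn⟩ := exists_adj_dist_eq h
  exact ⟨p, hp, by rw [level, root_eq_of_reachable hp.reachable, hn]⟩

/-- A shortest path from the root stays on smaller levels until its last vertex. In the minors
below, the smaller levels thus act as one contracted vertex. -/
theorem exists_walk_root (v : V) :
    ∃ w : G.Walk (G.root v) v, ∀ u ∈ w.support, u = v ∨ G.level u < G.level v := by
  induction h : G.level v using Nat.strong_induction_on generalizing v with
  | _ n ih =>
    cases n with
    | zero =>
      obtain hv := eq_root_of_level_eq_zero h
      exact ⟨Walk.nil.copy rfl hv.symm, fun u hu => Or.inl (by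
        rw [Walk.support_copy, Walk.support_nil, List.mem_singleton] at hu
        exact hu.trans hv.symm)⟩
    | succ n =>
      obtain ⟨p, hp, hpn⟩ := exists_parent h
      obtain ⟨w, hw⟩ := ih n (by omega) p hpn
      refine ⟨(w.copy (root_eq_of_reachable hp.reachable) rfl).concat hp, fun u hu => ?_⟩
      rw [Walk.support_concat, List.mem_append, List.mem_singleton,
        Walk.support_copy] at hu
      rcases hu with hu | rfl
      · rcases hw u hu with rfl | h
        · right; omega
        · right; omega
      · exact Or.inl rfl

theorem layerGraph_le : G.layerGraph ≤ G := fun _ _ h => h.1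

theorem level_eq_of_mem_support {u v : V} (p : G.layerGraph.Walk u v) :
    ∀ w ∈ p.support, G.level w = G.level u := by
  induction p with
  | nil => simp
  | cons h p ih =>
    intro w hw
    rw [Walk.support_cons, List.mem_cons] at hw
    rcases hw with rfl | hw
    · rfl
    · exact (ih w hw).trans h.2.symm

theorem level_eq_of_reachable_layerGraph {u v : V} (h : G.layerGraph.Reachable u v) :
    G.level u = G.level v :=
  h.elim fun p => (level_eq_of_mem_support p v p.end_mem_support).symm

theorem level_ne_zero_of_layerGraph_adj {u v : V} (h : G.layerGraph.Adj u v) :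
    G.level u ≠ 0 := by
  intro h0
  apply h.1.ne
  exact (eq_root_of_level_eq_zero h0).trans ((root_eq_of_reachable h.1.reachable).trans
    (eq_root_of_level_eq_zero (h.2.symm.trans h0)).symm)

/-- The vertex `c` and the root are the two hubs of a `K₂,₃`: the walks from the root reach the
three neighbors through smaller levels and so avoid `c`. -/
theorem IsOuterplanar.layerGraph_not_three [Finite V] (hG : G.IsOuterplanar) {c : V}
    {p : Fin 3 → V} (hp : Function.Injective p) (h : ∀ i, G.layerGraph.Adj c (p i)) : False := by
  have hroot : ∀ i, G.root (p i) = G.root c := fun i =>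
    root_eq_of_reachable (h i).1.symm.reachable
  refine hG.not_K23 (a := c) (b := G.root c) (p := p) (A := fun i => {c, p i})
    (B := fun i => {u | u = p i ∨ G.level u < G.level c}) ?_ ?_ ?_
  · exact fun i => ⟨(h i).1.toWalk, by simp⟩
  · intro i
    obtain ⟨w, hw⟩ := exists_walk_root (G := G) (p i)
    refine ⟨w.copy (hroot i) rfl, fun u hu => ?_⟩
    rw [Walk.support_copy] at hu
    rcases hw u hu with h' | h'
    · exact Or.inl h'
    · exact Or.inr (by rwa [(h i).2])
  · intro i j hij
    rw [Set.disjoint_left]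
    rintro u (rfl | rfl) (hu | hu)
    · exact (h j).1.ne hu
    · exact lt_irrefl _ hu
    · exact hij (hp hu)
    · rw [(h i).2] at hu
      exact lt_irrefl _ hu

/-- A vertex `v` of a cycle, its two neighbors `x` and `y` on the cycle, and the root form a `K₄`.
The rest of the cycle joins `x` to `y` within the level and without `v`. -/
theorem IsOuterplanar.layerGraph_isAcyclic [Finite V] (hG : G.IsOuterplanar) :
    G.layerGraph.IsAcyclic := by
  intro v c hc
  cases c with
  | nil => exact hc.not_nil Walk.nil_nil
  | @cons _ x _ hvx p =>
    obtain ⟨hp, he⟩ := Walk.cons_isCycle_iff p hvx |>.1 hc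
    rw [← Walk.isPath_reverse_iff] at hp
    have he' : s(v, x) ∉ p.reverse.edges := by simpa using he
    generalize p.reverse = p at hp he'
    cases p with
    | nil => exact hvx.1.ne rfl
    | @cons _ y _ hvy q =>
      have hyx : y ≠ x := by
        rintro rfl
        simp at he'
      have hvq : v ∉ q.support := (Walk.cons_isPath_iff _ _).1 hp |>.2
      have hlv := level_ne_zero_of_layerGraph_adj hvx
      have hlr := level_root (G := G) v
      have hlx := hvx.2
      have hly := hvy.2
      have hne : ∀ u, G.level u = G.level v → G.root v ≠ u := fun u hu e => by
        rw [← e, hlr] at hu; exact hlv hu.symm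
      have hinj : Function.Injective ![G.root v, v, x, y] := by
        have h0 := hne v rfl
        have h1 := hne x hlx.symm
        have h2 := hne y hly.symm
        have h3 := hvx.1.ne
        have h4 := hvy.1.ne
        intro i j hij
        fin_cases i <;> fin_cases j <;> first
          | rfl
          | exact absurd hij (by assumption)
          | exact absurd hij.symm (by assumption)
      have hroot : ∀ u, G.level u = G.level v → G.Reachable v u →
          ∃ w : G.Walk (G.root v) u, ∀ z ∈ w.support, z = u ∨ G.level z < G.level v := by
        intro u hu hvu
        obtain ⟨w, hw⟩ := exists_walk_root (G := G) u
        exact ⟨w.copy (root_eq_of_reachable hvu).symm rfl, fun z hz => by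
          rw [Walk.support_copy] at hz
          rw [← hu]; exact hw z hz⟩
      let A : Fin 4 → Fin 4 → Set V :=
        ![![∅, {z | z = v ∨ G.level z < G.level v}, {z | z = x ∨ G.level z < G.level v},
            {z | z = y ∨ G.level z < G.level v}],
          ![∅, ∅, {v, x}, {v, y}], ![∅, ∅, ∅, {z | G.level z = G.level v ∧ z ≠ v}],
          ![∅, ∅, ∅, ∅]]
      have e01 : A 0 1 = {z | z = v ∨ G.level z < G.level v} := rfl
      have e02 : A 0 2 = {z | z = x ∨ G.level z < G.level v} := rfl
      have e03 : A 0 3 = {z | z = y ∨ G.level z < G.level v} := rfl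
      have e12 : A 1 2 = {v, x} := rfl
      have e13 : A 1 3 = {v, y} := rfl
      have e23 : A 2 3 = {z | G.level z = G.level v ∧ z ≠ v} := rfl
      have d1 : Disjoint (A 0 1) (A 2 3) := by
        rw [e01, e23, Set.disjoint_left]
        rintro z (hz | hz) ⟨h1, h2⟩
        · exact h2 hz
        · omega
      have d2 : Disjoint (A 0 2) (A 1 3) := by
        rw [e02, e13, Set.disjoint_left]
        rintro z (hz | hz) (h1 | h1)
        · exact hvx.1.ne (h1.symm.trans hz)
        · exact hyx (h1.symm.trans hz)
        · subst h1; omega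
        · subst h1; omega
      have d3 : Disjoint (A 0 3) (A 1 2) := by
        rw [e03, e12, Set.disjoint_left]
        rintro z (hz | hz) (h1 | h1)
        · exact hvy.1.ne (h1.symm.trans hz)
        · exact hyx (hz.symm.trans h1)
        · subst h1; omega
        · subst h1; omega
      have w01 := hroot v rfl (Reachable.refl _)
      have w02 := hroot x hlx.symm hvx.1.reachable
      have w03 := hroot y hly.symm hvy.1.reachable
      have w12 : ∃ w : G.Walk v x, ∀ z ∈ w.support, z ∈ A 1 2 := ⟨hvx.1.toWalk, by simp [e12]⟩
      have w13 : ∃ w : G.Walk v y, ∀ z ∈ w.support, z ∈ A 1 3 := ⟨hvy.1.toWalk, by simp [e13]⟩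
      have w23 : ∃ w : G.Walk x y, ∀ z ∈ w.support, z ∈ A 2 3 :=
        ⟨q.reverse.mapLe layerGraph_le, fun z hz => by
          have hz' : z ∈ q.support := by simpa using hz
          refine ⟨(level_eq_of_mem_support q z hz').trans hly.symm, ?_⟩
          rintro rfl
          exact hvq hz'⟩
      refine hG.not_K4 (p := ![G.root v, v, x, y]) hinj (A := A) ?_ ?_ ?_
      · intro i j hij
        fin_cases i <;> fin_cases j <;> first | exact absurd hij (by decide) | assumption
      · have m : ∀ i j, i ≠ j → ![G.root v, v, x, y] i ≠ ![G.root v, v, x, y] j :=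
          fun i j h e => h (hinj e)
        intro i j k hjk hij hik
        have r12 : G.root v ∉ A 1 2 := fun h => h.elim (m 0 1 (by decide)) (m 0 2 (by decide))
        have r13 : G.root v ∉ A 1 3 := fun h => h.elim (m 0 1 (by decide)) (m 0 3 (by decide))
        have r23 : G.root v ∉ A 2 3 := fun h => by have := h.1; omega
        have v02 : v ∉ A 0 2 := fun h => h.elim hvx.1.ne (lt_irrefl _)
        have v03 : v ∉ A 0 3 := fun h => h.elim hvy.1.ne (lt_irrefl _)
        have v23 : v ∉ A 2 3 := fun h => h.2 rfl
        have x01 : x ∉ A 0 1 := fun h => h.elim hvx.1.ne' (by omega)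
        have x03 : x ∉ A 0 3 := fun h => h.elim hyx.symm (by omega)
        have x13 : x ∉ A 1 3 := fun h => h.elim hvx.1.ne' hyx.symm
        have y01 : y ∉ A 0 1 := fun h => h.elim hvy.1.ne' (by omega)
        have y02 : y ∉ A 0 2 := fun h => h.elim hyx (by omega)
        have y12 : y ∉ A 1 2 := fun h => h.elim hvy.1.ne' hyx
        fin_cases i <;> fin_cases j <;> fin_cases k <;>
          first
          | exact absurd hjk (by decide)
          | exact absurd rfl hij
          | exact absurd rfl hik
          | assumption
      · intro i j k l hij hkl hik hil hjk hjl
        have d1' := d1.symm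
        have d2' := d2.symm
        have d3' := d3.symm
        fin_cases i <;> fin_cases j <;> first
          | exact absurd hij (by decide)
          | (fin_cases k <;> fin_cases l <;> first
              | exact absurd hkl (by decide)
              | exact absurd rfl hik
              | exact absurd rfl hil
              | exact absurd rfl hjk
              | exact absurd rfl hjl
              | assumption)

/-- A forest of maximum degree two is a disjoint union of paths: its vertices have a position in
their component such that adjacency means consecutive positions in the same component. -/
theorem IsAcyclic.exists_path_positions [Finite V] {L : SimpleGraph V} (hL : L.IsAcyclic)
    (h3 : ∀ (c : V) (p : Fin 3 → V), Function.Injective p → (∀ i, L.Adj c (p i)) → False) :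
    ∃ (pos : V → ℕ) (len : L.ConnectedComponent → ℕ),
      (∀ u v, L.Adj u v ↔ L.connectedComponentMk u = L.connectedComponentMk v ∧
        (pos u + 1 = pos v ∨ pos v + 1 = pos u)) ∧
      (∀ u v, L.connectedComponentMk u = L.connectedComponentMk v → pos u = pos v → u = v) ∧
      (∀ v, pos v < len (L.connectedComponentMk v)) ∧
      (∀ v j, j < len (L.connectedComponentMk v) →
        ∃ w, L.connectedComponentMk w = L.connectedComponentMk v ∧ pos w = j) := by
  classical
  -- Each component is a tree, so it has an end vertex, or it is a single vertex. Positions are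
  -- distances from that end.
  have hleaf : ∀ C : L.ConnectedComponent, ∃ r, L.connectedComponentMk r = C ∧
      ∀ x y, L.Adj r x → L.Adj r y → x = y := by
    intro C
    have hT := hL.isTree_connectedComponent C
    by_cases hC : Nontrivial C
    · have : Fintype V := Fintype.ofFinite V
      obtain ⟨r, -, -, hr, -⟩ := hT.exists_ne_and_degree_eq_one
      obtain ⟨z, -, hz⟩ := degree_eq_one_iff_existsUnique_adj.1 hr
      refine ⟨r, r.2, fun x y hx hy => ?_⟩
      have hxC : x ∈ C.supp := (ConnectedComponent.sound hx.symm.reachable).trans r.2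
      have hyC : y ∈ C.supp := (ConnectedComponent.sound hy.symm.reachable).trans r.2
      have h1 := hz ⟨x, hxC⟩ hx
      have h2 := hz ⟨y, hyC⟩ hy
      exact congrArg Subtype.val (h1.trans h2.symm)
    · have hs : Subsingleton C := not_nontrivial_iff_subsingleton.1 hC
      obtain ⟨r, hr⟩ := C.exists_rep
      refine ⟨r, hr, fun x y hx hy => ?_⟩
      have hxC : x ∈ C.supp := (ConnectedComponent.sound hx.symm.reachable).trans hr
      have := congrArg Subtype.val (Subsingleton.elim (⟨x, hxC⟩ : C) ⟨r, hr⟩)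
      exact absurd this.symm hx.ne
  choose r hrC hr using hleaf
  let c : V → L.ConnectedComponent := L.connectedComponentMk
  let pos : V → ℕ := fun v => L.dist (r (c v)) v
  have hreach : ∀ v, L.Reachable (r (c v)) v := fun v => ConnectedComponent.exact (hrC (c v))
  have hcadj : ∀ {u v}, L.Adj u v → c u = c v := fun h => ConnectedComponent.sound h.reachable
  have hpred : ∀ v n, pos v = n + 1 → ∃ p, L.Adj p v ∧ c p = c v ∧ pos p = n := by
    intro v n h
    obtain ⟨p, hp, hn⟩ := exists_adj_dist_eq h
    exact ⟨p, hp, hcadj hp, by simp only [pos]; rw [hcadj hp]; exact hn⟩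
  -- Two vertices at the same distance have the same predecessor by induction. That predecessor
  -- would be an end with two neighbors, or have three neighbors counting its own predecessor.
  have hinj : ∀ n u v, c u = c v → pos u = n → pos v = n → u = v := by
    intro n
    induction n with
    | zero =>
      intro u v huv hu hv
      have h1 := (hreach u).dist_eq_zero_iff.1 hu
      have h2 := (hreach v).dist_eq_zero_iff.1 hv
      rw [← h1, ← h2, huv]
    | succ n ih =>
      intro u v huv hu hv
      obtain ⟨p, hp, hpc, hpn⟩ := hpred u n hu
      obtain ⟨q, hq, hqc, hqn⟩ := hpred v n hv
      obtain rfl : p = q := ih p q (by rw [hpc, hqc, huv]) hpn hqn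
      by_contra hne
      cases n with
      | zero =>
        have h1 := (hreach p).dist_eq_zero_iff.1 hpn
        exact hne (hr (c p) u v (h1.symm ▸ hp) (h1.symm ▸ hq))
      | succ n =>
        obtain ⟨z, hz, -, hzn⟩ := hpred p n hpn
        have hzu : z ≠ u := by rintro rfl; omega
        have hzv : z ≠ v := by rintro rfl; omega
        refine h3 p ![z, u, v] ?_ ?_
        · intro i j hij
          fin_cases i <;> fin_cases j <;> first
            | rfl
            | exact absurd hij (by assumption)
            | exact absurd hij.symm (by assumption)
        · intro i
          fin_cases i
          · exact hz.symm
          · exact hp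
          · exact hq
  have hmax : ∀ C : L.ConnectedComponent, ∃ m, (∀ v, c v = C → pos v ≤ m) ∧
      ∃ v, c v = C ∧ pos v = m := by
    intro C
    obtain ⟨v, hv, hm⟩ := Set.exists_max_image {v | c v = C} pos (Set.toFinite _) ⟨_, hrC C⟩
    exact ⟨pos v, fun u hu => hm u hu, v, hv, rfl⟩
  choose m hm hm' using hmax
  refine ⟨pos, fun C => m C + 1, fun u v => ⟨fun h => ⟨hcadj h, ?_⟩, ?_⟩,
    fun u v huv h => hinj _ u v huv h rfl, fun v => Nat.lt_succ_of_le (hm _ v rfl), ?_⟩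
  · have h1 := h.diff_dist_adj (u := r (c u))
    have hne : pos u ≠ pos v := fun e => h.ne (hinj _ u v (hcadj h) e rfl)
    have e2 : pos v = L.dist (r (c u)) v := by simp only [pos]; rw [hcadj h]
    have e1 : pos u = L.dist (r (c u)) u := rfl
    omega
  · have key : ∀ u v, c u = c v → pos u + 1 = pos v → L.Adj u v := by
      intro u v huv h
      obtain ⟨p, hp, hpc, hpn⟩ := hpred v (pos u) h.symm
      rwa [hinj _ u p (huv.trans hpc.symm) rfl hpn]
    rintro ⟨huv, h | h⟩
    · exact key u v huv h
    · exact (key v u huv.symm h).symm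
  · intro v j hj
    obtain ⟨w, hw, hwm⟩ := hm' (c v)
    have hdown : ∀ n j, j + n = m (c v) → ∃ w, c w = c v ∧ pos w = j := by
      intro n
      induction n with
      | zero => exact fun j hj => ⟨w, hw, by omega⟩
      | succ n ih =>
        intro j hj
        obtain ⟨z, hz, hzj⟩ := ih (j + 1) (by omega)
        obtain ⟨p, -, hpc, hpn⟩ := hpred z j hzj
        exact ⟨p, hpc.trans hz, hpn⟩
    have hj' : j < m (c v) + 1 := hj
    exact hdown (m (c v) - j) j (by omega)

end Layers

/-- A graph whose vertices have levels such that adjacent vertices have equal levels or levels of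
different parity, and such that the edges inside levels form disjoint paths, each of which is a
single vertex or has a neighbour on the level above. -/
structure PathLayering {V : Type*} (G : SimpleGraph V) (ι : Type*) where
  level : V → ℕ
  comp : V → ι
  pos : V → ℕ
  len : ι → ℕ
  par : V → V
  adj_iff : ∀ u v, (G.Adj u v ∧ level u = level v) ↔
    comp u = comp v ∧ (pos u + 1 = pos v ∨ pos v + 1 = pos u)
  pos_inj : ∀ u v, comp u = comp v → pos u = pos v → u = v
  pos_lt : ∀ v, pos v < len (comp v)
  exists_pos : ∀ v j, j < len (comp v) → ∃ w, comp w = comp v ∧ pos w = j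
  level_eq : ∀ u v, comp u = comp v → level u = level v
  odd_of_adj : ∀ u v, G.Adj u v → level u ≠ level v → Odd (level u + level v)
  par_adj : ∀ v, 1 < len (comp v) → G.Adj v (par v) ∧ level (par v) + 1 = level v

theorem IsOuterplanar.exists_pathLayering {V : Type*} [Finite V] {G : SimpleGraph V}
    (hG : G.IsOuterplanar) : Nonempty (G.PathLayering G.layerGraph.ConnectedComponent) := by
  obtain ⟨pos, len, hadj, hinj, hlt, hex⟩ := hG.layerGraph_isAcyclic.exists_path_positions
    (fun c p hp h => hG.layerGraph_not_three hp h)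
  have hpar : ∀ v, ∃ p, 1 < len (G.layerGraph.connectedComponentMk v) →
      G.Adj v p ∧ G.level p + 1 = G.level v := by
    intro v
    by_cases hv : 1 < len (G.layerGraph.connectedComponentMk v)
    · have hn : ∃ u, G.layerGraph.Adj v u := by
        have h1 := hlt v
        by_cases h0 : pos v = 0
        · obtain ⟨w, hw, hw1⟩ := hex v 1 hv
          exact ⟨w, (hadj v w).2 ⟨hw.symm, by omega⟩⟩
        · obtain ⟨w, hw, hw1⟩ := hex v (pos v - 1) (by omega)
          exact ⟨w, (hadj v w).2 ⟨hw.symm, by omega⟩⟩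
      obtain ⟨u, hu⟩ := hn
      obtain ⟨n, hn⟩ := Nat.exists_eq_succ_of_ne_zero (level_ne_zero_of_layerGraph_adj hu)
      obtain ⟨p, hp, hpn⟩ := exists_parent hn
      exact ⟨p, fun _ => ⟨hp.symm, by omega⟩⟩
    · exact ⟨v, fun h => absurd h hv⟩
  choose par hpar using hpar
  exact ⟨{
    level := G.level
    comp := G.layerGraph.connectedComponentMk
    pos := pos
    len := len
    par := par
    adj_iff := hadj
    pos_inj := hinj
    pos_lt := hlt
    exists_pos := hex
    level_eq := fun u v h => level_eq_of_reachable_layerGraph (ConnectedComponent.exact h)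
    odd_of_adj := fun u v h hne => by
      rcases level_of_adj h with h | h | h
      · exact absurd h hne
      · exact ⟨G.level u, by omega⟩
      · exact ⟨G.level v, by omega⟩
    par_adj := hpar }⟩

end SimpleGraph

namespace SimpleGraph

/-! ### Two-coloring the edges of a path -/

/-- Number of edges of color `c` at position `i` of a path with `n` vertices, when the edge that
enters position `i > 0` has color `e i`. -/
def pathDegree (n : ℕ) (e : ℕ → Bool) (i : ℕ) (c : Bool) : ℕ :=
  (if 0 < i ∧ e i = c then 1 else 0) + (if i + 1 < n ∧ e (i + 1) = c then 1 else 0)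

/-- Degree in color `c` at position `i` of a path with `n` vertices that is entered by an edge of
color `e 0`, where position `i` carries `x i c` additional half-edges of color `c`. -/
def extDegree (n : ℕ) (e : ℕ → Bool) (x : ℕ → Bool → ℕ) (i : ℕ) (c : Bool) : ℕ :=
  (if e i = c then 1 else 0) + (if i + 1 < n ∧ e (i + 1) = c then 1 else 0) + x i c

/-- A path on `n` vertices entered by an edge of color `c` from a vertex of degree `k` can be
colored, where position `i` carries `t i` additional half-edges. -/
def PathExtendable (n : ℕ) (t : ℕ → ℕ) (k : ℕ) (c : Bool) : Prop :=
  ∃ (e : ℕ → Bool) (x : ℕ → Bool → ℕ), e 0 = c ∧ (∀ i, x i true + x i false = t i) ∧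
    extDegree n e x 0 c ≠ k ∧
    ∀ i, i + 1 < n → extDegree n e x i (e (i + 1)) ≠ extDegree n e x (i + 1) (e (i + 1))

theorem exists_split (m a : ℕ) (c : Bool) (h : a ≤ m) :
    ∃ y : Bool → ℕ, y true + y false = m ∧ y c = a ∧ y (!c) = m - a := by
  refine ⟨fun d => if d = c then a else m - a, ?_, by simp, by simp⟩
  cases c <;> simp <;> omega

theorem PathExtendable.one {t : ℕ → ℕ} {k : ℕ} {c : Bool} (a : ℕ) (h : a ≤ t 0) (hk : 1 + a ≠ k) :
    PathExtendable 1 t k c := by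
  choose y hy using fun i => exists_split (t i) (if i = 0 then a else 0) c (by
    split_ifs with hi
    · rwa [hi]
    · exact Nat.zero_le _)
  refine ⟨fun _ => c, y, rfl, fun i => (hy i).1, ?_, fun i hi => absurd hi (by omega)⟩
  simpa [extDegree, (hy 0).2.1] using hk

/-- Removing the first vertex leaves a shorter path entered by the edge of color `d`. The new
forbidden degree is that of the removed vertex in color `d`. -/
theorem PathExtendable.cons {n : ℕ} {t : ℕ → ℕ} {k : ℕ} {c d : Bool} {y : Bool → ℕ} (hn : 0 < n)
    (hy : y true + y false = t 0) (hk : 1 + (if d = c then 1 else 0) + y c ≠ k)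
    (h : PathExtendable n (fun i => t (i + 1)) ((if d = c then 1 else 0) + 1 + y d) d) :
    PathExtendable (n + 1) t k c := by
  obtain ⟨e, x, he, hx, hk', hstep⟩ := h
  refine ⟨fun i => Nat.casesOn i c e, fun i => Nat.casesOn i y x, rfl, ?_, ?_, ?_⟩
  · rintro (_ | i)
    · exact hy
    · exact hx i
  · have h0 : (1 : ℕ) + (if d = c then 1 else 0) + y c =
        (if c = c then 1 else 0) + (if 0 + 1 < n + 1 ∧ e 0 = c then 1 else 0) + y c := by
      simp [hn, he]
    rw [h0] at hk
    exact hk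
  · have hsucc : ∀ i d', extDegree (n + 1) (fun i => Nat.casesOn i c e)
        (fun i => Nat.casesOn i y x) (i + 1) d' = extDegree n e x i d' := by
      intro i d'
      simp [extDegree]
    rintro (_ | i) hi
    · rw [hsucc]
      have h0 : (if d = c then 1 else 0) + 1 + y d =
          (if c = d then 1 else 0) + (if 0 + 1 < n + 1 ∧ e 0 = d then 1 else 0) + y d := by
        simp [hn, he, eq_comm]
      intro h
      refine hk' (Eq.trans ?_ (Eq.trans h.symm ?_))
      · change _ = extDegree n e x 0 (e 0)
        rw [he]
      · change (if c = e 0 then 1 else 0) + (if 0 + 1 < n + 1 ∧ e 0 = e 0 then 1 else 0) + y (e 0) = _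
        rw [h0, he]
    · rw [hsucc, hsucc]
      exact hstep i (by omega)

/-- Without half-edges, keeping the color forces degree 2 and changing it forces degree 1. The
forbidden value of `k` therefore alternates between 1 and 2 with the parity of `n`. One half-edge
anywhere breaks this rigidity. -/
theorem pathExtendable_of {n : ℕ} (hn : 0 < n) {t : ℕ → ℕ} {k : ℕ} (c : Bool) (hk : 1 ≤ k)
    (h : (∃ i < n, t i ≠ 0) ∨ (Odd n ∧ k ≠ 1) ∨ (Even n ∧ k ≠ 2)) : PathExtendable n t k c := by
  induction n, hn using Nat.le_induction generalizing t k c with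
  | base =>
    by_cases h1 : k = 1
    · refine .one (t 0) le_rfl ?_
      have : t 0 ≠ 0 := by
        rcases h with ⟨i, hi, h⟩ | h | h
        · rwa [Nat.lt_one_iff.1 hi] at h
        · exact absurd h1 h.2
        · exact absurd h.1 (by decide)
      omega
    · exact .one 0 (Nat.zero_le _) (by omega)
  | succ n hn ih =>
    have hn' : 0 < n := hn
    -- The next edge keeps the color `c`, and `a` half-edges at the first vertex get `c`.
    have same : ∀ a, a ≤ t 0 → 2 + a ≠ k →
        ((∃ i < n, t (i + 1) ≠ 0) ∨ (Odd n ∧ 2 + a ≠ 1) ∨ (Even n ∧ 2 + a ≠ 2)) →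
        PathExtendable (n + 1) t k c := by
      intro a ha hak h
      obtain ⟨y, hy, hyc, -⟩ := exists_split (t 0) a c ha
      refine .cons (d := c) hn' hy (by simpa [hyc] using hak) ?_
      simpa [hyc] using ih (t := fun i => t (i + 1)) (k := 2 + a) c (by omega) h
    -- The next edge changes color; again `a` half-edges get `c`, and the others join the new color.
    have diff : ∀ a, a ≤ t 0 → 1 + a ≠ k →
        ((∃ i < n, t (i + 1) ≠ 0) ∨ (Odd n ∧ 1 + (t 0 - a) ≠ 1) ∨
          (Even n ∧ 1 + (t 0 - a) ≠ 2)) → PathExtendable (n + 1) t k c := by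
      intro a ha hak h
      obtain ⟨y, hy, hyc, hyd⟩ := exists_split (t 0) a c ha
      refine .cons (d := !c) hn' hy (by simpa [hyc] using hak) ?_
      simpa [hyd] using ih (t := fun i => t (i + 1)) (k := 1 + (t 0 - a)) (!c) (by omega) h
    by_cases h0 : t 0 = 0
    · have h' : (∃ i < n, t (i + 1) ≠ 0) ∨ (Odd (n + 1) ∧ k ≠ 1) ∨ (Even (n + 1) ∧ k ≠ 2) := by
        rcases h with ⟨i, hi, h⟩ | h | h
        · rcases i with _ | i
          · exact absurd h0 h
          · exact Or.inl ⟨i, by omega, h⟩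
        · exact Or.inr (Or.inl h)
        · exact Or.inr (Or.inr h)
      rcases h' with h | ⟨hp, h⟩ | ⟨hp, h⟩
      · by_cases h1 : k = 1
        · exact same 0 (Nat.zero_le _) (by omega) (Or.inl h)
        · exact diff 0 (Nat.zero_le _) (by omega) (Or.inl h)
      · exact diff 0 (Nat.zero_le _) (by omega) (Or.inr (Or.inr ⟨by grind, by omega⟩))
      · exact same 0 (Nat.zero_le _) (by omega) (Or.inr (Or.inl ⟨by grind, by omega⟩))
    · by_cases h2 : k = 2
      · refine same 1 (by omega) (by omega) (Or.inr ?_)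
        rcases Nat.even_or_odd n with hp | hp
        · exact Or.inr ⟨hp, by omega⟩
        · exact Or.inl ⟨hp, by omega⟩
      · rcases Nat.even_or_odd n with hp | hp
        · by_cases h1 : k = 1
          · exact diff (t 0) le_rfl (by omega) (Or.inr (Or.inr ⟨hp, by omega⟩))
          · by_cases ht : t 0 = 1
            · exact diff 1 (by omega) (by omega) (Or.inr (Or.inr ⟨hp, by omega⟩))
            · exact diff 0 (by omega) (by omega) (Or.inr (Or.inr ⟨hp, by omega⟩))
        · exact same 0 (Nat.zero_le _) (by omega) (Or.inr (Or.inl ⟨hp, by omega⟩))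

/-- The edges of a path and the additional half-edges at its vertices can be colored with two
colors so that the ends of each edge have distinct degrees in its color, unless the path has an even
number of vertices and there are no additional half-edges. -/
theorem exists_path_coloring (n : ℕ) (t : ℕ → ℕ) (h : Even n → ∃ i < n, t i ≠ 0) :
    ∃ (e : ℕ → Bool) (x : ℕ → Bool → ℕ), (∀ i, x i true + x i false = t i) ∧
      ∀ i, i + 1 < n → pathDegree n e i (e (i + 1)) + x i (e (i + 1)) ≠
        pathDegree n e (i + 1) (e (i + 1)) + x (i + 1) (e (i + 1)) := by
  by_cases hn : n ≤ 1
  · exact ⟨fun _ => true, fun i c => if c then t i else 0, by simp, fun i hi => by omega⟩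
  · obtain ⟨m, rfl⟩ : ∃ m, n = m + 1 := ⟨n - 1, by omega⟩
    -- The first edge gets color `true`, so the first vertex has degree `1 + a`. If its half-edges
    -- are the only resource, all of them are spent to avoid degree 1.
    have key : ∃ a ≤ t 0, PathExtendable m (fun i => t (i + 1)) (1 + a) true := by
      rcases Nat.even_or_odd m with hp | hp
      · exact ⟨0, Nat.zero_le _, pathExtendable_of (by omega) _ (by omega)
          (Or.inr (Or.inr ⟨hp, by omega⟩))⟩
      · obtain ⟨i, hi, ht⟩ := h (by grind)
        rcases i with _ | i
        · exact ⟨t 0, le_rfl, pathExtendable_of (by omega) _ (by omega)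
            (Or.inr (Or.inl ⟨hp, by omega⟩))⟩
        · exact ⟨0, Nat.zero_le _, pathExtendable_of (by omega) _ (by omega)
            (Or.inl ⟨i, by omega, ht⟩)⟩
    obtain ⟨a, ha, hext⟩ := key
    obtain ⟨y, hy, hya, -⟩ := exists_split (t 0) a true ha
    obtain ⟨e, x, he, hx, hk, hstep⟩ := hext
    refine ⟨fun i => Nat.casesOn i true e, fun i => Nat.casesOn i y x, ?_, ?_⟩
    · rintro (_ | i)
      · exact hy
      · exact hx i
    · have hsucc : ∀ i d, pathDegree (m + 1) (fun i => Nat.casesOn i true e) (i + 1) d + x i d =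
          extDegree m e x i d := by
        intro i d
        simp [extDegree, pathDegree]
      rintro (_ | i) hi
      · have h0 : pathDegree (m + 1) (fun i => Nat.casesOn i true e) 0 true = 1 := by
          simp [pathDegree, he]
          omega
        intro h
        refine hk (Eq.trans ?_ (Eq.trans h.symm ?_))
        · change _ = pathDegree (m + 1) (fun i => Nat.casesOn i true e) (0 + 1) (e 0) + x 0 (e 0)
          rw [hsucc, he]
        · change pathDegree (m + 1) (fun i => Nat.casesOn i true e) 0 (e 0) + y (e 0) = _
          rw [he, h0, hya]
      · change pathDegree (m + 1) (fun i => Nat.casesOn i true e) (i + 1) (e (i + 1)) +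
          x i (e (i + 1)) ≠ pathDegree (m + 1) (fun i => Nat.casesOn i true e) (i + 1 + 1)
            (e (i + 1)) + x (i + 1) (e (i + 1))
        rw [hsucc, hsucc]
        exact hstep i (by omega)

/-- The edges of a path alternate in pairs, starting with a single edge of color `c`. -/
def pairColor (c : Bool) (i : ℕ) : Bool := if i % 4 = 0 ∨ i % 4 = 1 then c else !c

theorem pathDegree_pairColor {n : ℕ} (hn : Even n) (c : Bool) {i : ℕ} (h0 : 0 < i)
    (hi : i + 1 < n) : pathDegree n (pairColor c) i (pairColor c (i + 1)) ≠
      pathDegree n (pairColor c) (i + 1) (pairColor c (i + 1)) := by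
  obtain ⟨m, rfl⟩ := hn
  have h4 : i % 4 = 0 ∨ i % 4 = 1 ∨ i % 4 = 2 ∨ i % 4 = 3 := by omega
  -- With `n` even, the pairs after the initial single edge are complete: each has a middle vertex
  -- of degree 2 and ends of degree 1.
  have hi2 : i % 2 = 1 → i + 2 < m + m := by omega
  rcases h4 with h | h | h | h
  · have h1 : (i + 1) % 4 = 1 := by omega
    have h2 : (i + 2) % 4 = 2 := by omega
    simp [pathDegree, pairColor, h, h1, h2, h0, hi]
  · have h1 : (i + 1) % 4 = 2 := by omega
    have h2 : (i + 2) % 4 = 3 := by omega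
    simp [pathDegree, pairColor, h, h1, h2, hi, hi2 (by omega)]
  · have h1 : (i + 1) % 4 = 3 := by omega
    have h2 : (i + 2) % 4 = 0 := by omega
    simp [pathDegree, pairColor, h, h1, h2, h0, hi]
  · have h1 : (i + 1) % 4 = 0 := by omega
    have h2 : (i + 2) % 4 = 1 := by omega
    simp [pathDegree, pairColor, h, h1, h2, hi, hi2 (by omega)]

theorem pathDegree_pairColor_zero {n : ℕ} (hn : 1 < n) (c : Bool) :
    pathDegree n (pairColor c) 0 c = 1 := by
  simp [pathDegree, pairColor, hn]

theorem pathDegree_pairColor_one {n : ℕ} (c : Bool) :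
    pathDegree n (pairColor c) 1 c = 1 := by
  simp [pathDegree, pairColor]

/-- Isolates the bookkeeping with edge labels and incidence sets: total degrees enter only through
the counts that characterize them. -/
theorem TLIRColorable.of_symm_coloring {V K : Type*} [Fintype K] {G : SimpleGraph V}
    (f : V → V → K) (g : V → K) (hf : ∀ u v, G.Adj u v → f u v = f v u)
    (hd : ∀ (d : K → V → ℕ), (∀ a v, ({w | G.Adj v w ∧ f v w = a}.ncard = d a v ∧ g v ≠ a) ∨
      ({w | G.Adj v w ∧ f v w = a}.ncard + 1 = d a v ∧ g v = a)) →
        ∀ u v, G.Adj u v → d (f u v) u ≠ d (f u v) v) : G.TLIRColorable (Fintype.card K) := by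
  classical
  let σ := Fintype.equivFin K
  let c : G.TotalColoring (Fin (Fintype.card K)) :=
    ⟨fun v => σ (g v), EdgeLabeling.mk (fun u v _ => σ (f u v))
      (fun u v h => congrArg σ (hf v u h.symm))⟩
  refine ⟨c, fun a u v huv => ?_⟩
  have hadj : ∀ a u v, (c.edgeColor.labelGraph (σ a)).Adj u v ↔ G.Adj u v ∧ f u v = a := by
    intro a u v
    rw [EdgeLabeling.labelGraph_adj]
    constructor
    · rintro ⟨h, h'⟩
      exact ⟨h, σ.injective h'⟩
    · rintro ⟨h, h'⟩
      exact ⟨h, congrArg σ h'⟩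
  obtain ⟨a, rfl⟩ := σ.surjective a
  have huv' := (hadj a u v).1 huv
  have := hd (fun a v => (c.colorClass (σ a)).totalDegree v) (fun a v => ?_) u v huv'.1
  · rwa [huv'.2] at this
  · have hs : {w | G.Adj v w ∧ f v w = a} = (c.edgeColor.labelGraph (σ a)).neighborSet v :=
      Set.ext fun w => (hadj a v w).symm
    have hcard : {w | G.Adj v w ∧ f v w = a}.ncard =
        ((c.edgeColor.labelGraph (σ a)).incidenceSet v).ncard := by
      rw [hs]
      exact (Nat.card_congr ((c.edgeColor.labelGraph (σ a)).incidenceSetEquivNeighborSet v)).symm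
    by_cases h : g v = a
    · right
      refine ⟨?_, h⟩
      have : v ∈ (c.colorClass (σ a)).fullVerts := congrArg σ h
      simp only [TotalGraph.totalDegree, if_pos this, hcard]
      rfl
    · left
      refine ⟨?_, h⟩
      have : v ∉ (c.colorClass (σ a)).fullVerts := fun h' => h (σ.injective h')
      simp only [TotalGraph.totalDegree, if_neg this, hcard]
      rfl

end SimpleGraph

namespace SimpleGraph

/-! ### Coloring a graph with a path layering -/

namespace PathLayering

variable {V ι : Type*} {G : SimpleGraph V} (P : G.PathLayering ι)

/-- The neighbors of a vertex on other levels. -/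
def cross (v : V) : Set V := {x | G.Adj v x ∧ P.level v ≠ P.level x}

/-- The first vertices of those paths that cannot be colored without recoloring an edge to the
level above: paths with an even number of vertices, none of which is the upper end of a recolored
edge or has the parity that permits another color than that of the edges between levels. -/
def IsHeadSet (U : Set V) : Prop :=
  ∀ u, u ∈ U ↔ P.pos u = 0 ∧ Even (P.len (P.comp u)) ∧ ∀ v, P.comp v = P.comp u →
    (∀ w ∈ U, P.par w ≠ v) ∧ Odd ((P.cross v).ncard + P.level v)

variable {P}

theorem one_lt_len_of_even {v : V} (h : Even (P.len (P.comp v))) : 1 < P.len (P.comp v) := by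
  have := P.pos_lt v
  obtain ⟨m, hm⟩ := h
  omega

variable (P) in
theorem exists_isHeadSet [Finite V] : ∃ U, P.IsHeadSet U := by
  -- Recursion from deep levels upward: a head whose parent lies on the path of `u` is exactly one
  -- level deeper than `u`.
  let r : V → V → Prop := fun w u => P.level u < P.level w
  have : IsTrans V r := ⟨fun _ _ _ h h' => lt_trans h' h⟩
  have : Std.Irrefl r := ⟨fun _ h => lt_irrefl _ h⟩
  have hwf : WellFounded r := Finite.wellFounded_of_trans_of_irrefl r
  let F : ∀ u, (∀ w, r w u → Prop) → Prop := fun u ih =>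
    P.pos u = 0 ∧ Even (P.len (P.comp u)) ∧ ∀ v, P.comp v = P.comp u →
      (∀ w (h : r w u), ih w h → P.par w ≠ v) ∧ Odd ((P.cross v).ncard + P.level v)
  refine ⟨{u | hwf.fix F u}, ?_⟩
  have key : ∀ u, hwf.fix F u ↔ P.pos u = 0 ∧ Even (P.len (P.comp u)) ∧
      ∀ v, P.comp v = P.comp u → (∀ w, r w u → hwf.fix F w → P.par w ≠ v) ∧
        Odd ((P.cross v).ncard + P.level v) := fun u => by
    rw [hwf.fix_eq]
  intro u
  refine (key u).trans ?_
  refine and_congr_right fun _ => and_congr_right fun _ => forall_congr' fun v =>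
    forall_congr' fun hv => and_congr_left fun _ => forall_congr' fun w => ?_
  constructor
  · intro h hw hwv
    refine h ?_ hw hwv
    have := (P.par_adj w (one_lt_len_of_even ((key w).1 hw).2.1)).2
    rw [hwv, P.level_eq v u hv] at this
    change P.level u < P.level w
    omega
  · exact fun h _ hw => h hw

/-- The neighbors of a vertex that are joined to it by an edge between levels that is not
recolored. -/
def plainCross (P : G.PathLayering ι) (U : Set V) (v : V) : Set V :=
  {x | G.Adj v x ∧ P.level v ≠ P.level x ∧ ¬ (v ∈ U ∧ P.par v = x) ∧ ¬ (x ∈ U ∧ P.par x = v)}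

/-- The vertices that receive the color of the edges between levels. -/
def IsPlain (P : G.PathLayering ι) (U : Set V) (v : V) : Prop :=
  Odd ((P.plainCross U v).ncard + P.level v)

open Classical in
/-- The additional half-edges at a vertex: recolored edges to lower levels, given by their lower
ends, and the vertex itself. -/
def items (P : G.PathLayering ι) (U : Set V) (v : V) : Set V :=
  {w | (if w ∈ U then P.par w else w) = v ∧ (w ∈ U ∨ ¬ P.IsPlain U w)}

/-- The paths that start at a given set of vertices. -/
def IsBad (P : G.PathLayering ι) (U : Set V) (i : ι) : Prop := ∃ u ∈ U, P.comp u = i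

variable {U : Set V}

theorem plainCross_eq_cross {v : V} (hv : v ∉ U) (h : ∀ w ∈ U, P.par w ≠ v) :
    P.plainCross U v = P.cross v := by
  ext x
  simp only [plainCross, cross, Set.mem_ofPred_eq]
  have := h x
  tauto

theorem IsHeadSet.one_lt_len (hU : P.IsHeadSet U) {u : V} (hu : u ∈ U) :
    1 < P.len (P.comp u) := one_lt_len_of_even ((hU u).1 hu).2.1

theorem IsHeadSet.par_adj (hU : P.IsHeadSet U) {u : V} (hu : u ∈ U) :
    G.Adj u (P.par u) ∧ P.level (P.par u) + 1 = P.level u := P.par_adj u (hU.one_lt_len hu)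

theorem IsHeadSet.of_isBad (hU : P.IsHeadSet U) {v : V} (hv : P.IsBad U (P.comp v)) :
    (∀ w ∈ U, P.par w ≠ v) ∧ Odd ((P.cross v).ncard + P.level v) := by
  obtain ⟨u, hu, huv⟩ := hv
  exact ((hU u).1 hu).2.2 v huv.symm

/-- An even path without items satisfies all conditions on a head at its first vertex, so it would
be bad. -/
theorem IsHeadSet.exists_items_nonempty (hU : P.IsHeadSet U) {v : V}
    (hv : ¬ P.IsBad U (P.comp v)) (hlen : Even (P.len (P.comp v))) :
    ∃ w, P.comp w = P.comp v ∧ (P.items U w).Nonempty := by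
  by_contra! hcon
  obtain ⟨u, huc, hu0⟩ := P.exists_pos v 0 (one_lt_len_of_even hlen).le
  refine hv ⟨u, (hU u).2 ⟨hu0, huc ▸ hlen, fun w hw => ?_⟩, huc⟩
  have hwv := hw.trans huc
  have hempty := hcon w hwv
  have hwU : w ∉ U := fun h => hv ⟨w, h, hwv⟩
  have hpar : ∀ x ∈ U, P.par x ≠ w := fun x hx h =>
    Set.eq_empty_iff_forall_notMem.1 hempty x ⟨by rw [if_pos hx, h], Or.inl hx⟩
  refine ⟨hpar, ?_⟩
  rw [← plainCross_eq_cross hwU hpar]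
  by_contra hplain
  exact Set.eq_empty_iff_forall_notMem.1 hempty w ⟨if_neg hwU, Or.inr hplain⟩

theorem IsHeadSet.exists_path_colorings [Finite V] (hU : P.IsHeadSet U) :
    ∃ (E : ι → ℕ → Bool) (X : V → Bool → ℕ),
      (∀ v, X v true + X v false = (P.items U v).ncard) ∧
      ∀ u v, P.comp u = P.comp v → ¬ P.IsBad U (P.comp v) → P.pos u + 1 = P.pos v →
        pathDegree (P.len (P.comp v)) (E (P.comp v)) (P.pos u) (E (P.comp v) (P.pos v)) +
          X u (E (P.comp v) (P.pos v)) ≠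
        pathDegree (P.len (P.comp v)) (E (P.comp v)) (P.pos v) (E (P.comp v) (P.pos v)) +
          X v (E (P.comp v) (P.pos v)) := by
  classical
  have key : ∀ i, ∃ (e : ℕ → Bool) (x : ℕ → Bool → ℕ),
      (∀ v, P.comp v = i → x (P.pos v) true + x (P.pos v) false = (P.items U v).ncard) ∧
      ∀ u v, P.comp u = i → P.comp v = i → ¬ P.IsBad U i → P.pos u + 1 = P.pos v →
        pathDegree (P.len i) e (P.pos u) (e (P.pos v)) + x (P.pos u) (e (P.pos v)) ≠
        pathDegree (P.len i) e (P.pos v) (e (P.pos v)) + x (P.pos v) (e (P.pos v)) := by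
    intro i
    let t : ℕ → ℕ := fun j =>
      if h : ∃ v, P.comp v = i ∧ P.pos v = j then (P.items U h.choose).ncard else 0
    have ht : ∀ v, P.comp v = i → t (P.pos v) = (P.items U v).ncard := by
      intro v hv
      have h : ∃ w, P.comp w = i ∧ P.pos w = P.pos v := ⟨v, hv, rfl⟩
      have he : h.choose = v :=
        P.pos_inj _ _ (h.choose_spec.1.trans hv.symm) h.choose_spec.2
      simp only [t, dif_pos h, he]
    by_cases hn : Even (P.len i) → ∃ j < P.len i, t j ≠ 0
    · obtain ⟨e, x, hx, he⟩ := exists_path_coloring (P.len i) t hn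
      refine ⟨e, x, fun v hv => (hx _).trans (ht v hv), fun u v hu hv _ huv => ?_⟩
      have := he (P.pos u) (by rw [huv]; exact hv ▸ P.pos_lt v)
      rwa [huv] at this
    -- An even path without items is bad, so nothing is claimed about its edges here; they are
    -- colored by `pairColor` later.
    · refine ⟨fun _ => true, fun j c => if c then t j else 0, fun v hv => by simp [ht v hv],
        fun u v _ hv hbad _ => (hn fun heven => ?_).elim⟩
      subst hv
      obtain ⟨w, hw, hne⟩ := hU.exists_items_nonempty hbad heven
      refine ⟨P.pos w, hw ▸ P.pos_lt w, ?_⟩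
      rw [ht w hw]
      exact ((Set.ncard_pos).2 hne).ne'
  choose E x hx hE using key
  refine ⟨E, fun v => x (P.comp v) (P.pos v), fun v => hx _ v rfl, fun u v huv hbad h => ?_⟩
  simp only [huv]
  exact hE _ u v huv rfl hbad h

/-- Every item belongs to exactly one vertex, so the numbers prescribed at different vertices can be
realized independently. -/
theorem exists_item_coloring [Finite V] {X : V → Bool → ℕ}
    (hX : ∀ v, X v true + X v false = (P.items U v).ncard) :
    ∃ κ : V → Bool, ∀ v c, {w | w ∈ P.items U v ∧ κ w = c}.ncard = X v c := by
  classical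
  have hS : ∀ v, ∃ S ⊆ P.items U v, S.ncard = X v true := fun v =>
    Set.exists_subset_card_eq (by rw [← hX v]; exact Nat.le_add_right _ _)
  choose S hS hcard using hS
  refine ⟨fun w => decide (w ∈ S (if w ∈ U then P.par w else w)), fun v c => ?_⟩
  have hdec : ∀ w ∈ P.items U v, (if w ∈ U then P.par w else w) = v := fun w hw => hw.1
  cases c
  · have : {w | w ∈ P.items U v ∧ decide (w ∈ S (if w ∈ U then P.par w else w)) = false} =
        P.items U v \ S v := by
      ext w
      simp only [Set.mem_ofPred_eq, Set.mem_sdiff, decide_eq_false_iff_not]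
      exact and_congr_right fun hw => by rw [hdec w hw]
    rw [this, Set.ncard_sdiff (hS v), hcard, ← hX v]
    omega
  · have : {w | w ∈ P.items U v ∧ decide (w ∈ S (if w ∈ U then P.par w else w)) = true} = S v := by
      ext w
      simp only [Set.mem_ofPred_eq, decide_eq_true_eq]
      exact ⟨fun h => by have := h.2; rwa [hdec w h.1] at this,
        fun h => ⟨hS v h, by rwa [hdec w (hS v h)]⟩⟩
    rw [this, hcard]

open Classical in
/-- The edge coloring: `none` for the edges between levels that are not recolored, `F` for the
edges of the paths, and `κ` for the recolored edges. -/
noncomputable def edgeColoring (P : G.PathLayering ι) (U : Set V) (F : ι → ℕ → Bool) (κ : V → Bool)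
    (x y : V) : Option Bool :=
  if P.level x = P.level y then some (F (P.comp x) (max (P.pos x) (P.pos y)))
  else if x ∈ U ∧ P.par x = y then some (κ x)
  else if y ∈ U ∧ P.par y = x then some (κ y)
  else none

theorem IsHeadSet.edgeColoring_comm (hU : P.IsHeadSet U) (F : ι → ℕ → Bool) (κ : V → Bool)
    {x y : V} (h : G.Adj x y) : P.edgeColoring U F κ x y = P.edgeColoring U F κ y x := by
  unfold edgeColoring
  by_cases hl : P.level x = P.level y
  · rw [if_pos hl, if_pos hl.symm, ((P.adj_iff x y).1 ⟨h, hl⟩).1, max_comm]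
  · rw [if_neg hl, if_neg (Ne.symm hl)]
    by_cases h1 : x ∈ U ∧ P.par x = y
    · have h2 : ¬ (y ∈ U ∧ P.par y = x) := fun h2 => by
        have e1 := (hU.par_adj h1.1).2
        have e2 := (hU.par_adj h2.1).2
        rw [h1.2] at e1
        rw [h2.2] at e2
        omega
      rw [if_pos h1, if_neg h2, if_pos h1]
    · rw [if_neg h1, if_neg h1]

theorem edgeColoring_eq_none {F : ι → ℕ → Bool} {κ : V → Bool} (v : V) :
    {w | G.Adj v w ∧ P.edgeColoring U F κ v w = none} = P.plainCross U v := by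
  ext w
  simp only [Set.mem_ofPred_eq, plainCross, edgeColoring]
  refine and_congr_right fun _ => ?_
  split_ifs <;> simp_all

-- The neighbors counted are the predecessor and successor on the path, the heads whose recolored
-- edge ends at `v`, and the parent if `v` is itself a head.
open Classical in
theorem IsHeadSet.ncard_edgeColoring_eq_some [Finite V] (hU : P.IsHeadSet U) (F : ι → ℕ → Bool)
    (κ : V → Bool) (v : V) (c : Bool) :
    {w | G.Adj v w ∧ P.edgeColoring U F κ v w = some c}.ncard =
      pathDegree (P.len (P.comp v)) (F (P.comp v)) (P.pos v) c +
        {w | w ∈ U ∧ P.par w = v ∧ κ w = c}.ncard + (if v ∈ U ∧ κ v = c then 1 else 0) := by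
  let S₁ : Set V := {w | P.comp w = P.comp v ∧ P.pos w + 1 = P.pos v ∧ F (P.comp v) (P.pos v) = c}
  let S₂ : Set V :=
    {w | P.comp w = P.comp v ∧ P.pos w = P.pos v + 1 ∧ F (P.comp v) (P.pos v + 1) = c}
  let S₃ : Set V := {w | w ∈ U ∧ P.par w = v ∧ κ w = c}
  let S₄ : Set V := {w | v ∈ U ∧ P.par v = w ∧ κ v = c}
  have l₁ : ∀ w ∈ S₁, P.level w = P.level v := fun w hw => P.level_eq _ _ hw.1
  have l₂ : ∀ w ∈ S₂, P.level w = P.level v := fun w hw => P.level_eq _ _ hw.1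
  have l₃ : ∀ w ∈ S₃, P.level v + 1 = P.level w := fun w hw => by
    have := (hU.par_adj hw.1).2
    rwa [hw.2.1] at this
  have l₄ : ∀ w ∈ S₄, P.level w + 1 = P.level v := fun w hw => by
    have := (hU.par_adj hw.1).2
    rwa [hw.2.1] at this
  have c₁ : S₁.ncard = if 0 < P.pos v ∧ F (P.comp v) (P.pos v) = c then 1 else 0 := by
    split_ifs with h
    · have := P.pos_lt v
      obtain ⟨w, hw, hwp⟩ := P.exists_pos v (P.pos v - 1) (by omega)
      rw [Set.ncard_eq_one]
      refine ⟨w, Set.eq_singleton_iff_unique_mem.2 ⟨⟨hw, by omega, h.2⟩, fun z hz => ?_⟩⟩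
      exact P.pos_inj _ _ (hz.1.trans hw.symm) (by have := hz.2.1; omega)
    · rw [Set.ncard_eq_zero]
      exact Set.eq_empty_iff_forall_notMem.2 fun w hw => h ⟨by have := hw.2.1; omega, hw.2.2⟩
  have c₂ : S₂.ncard =
      if P.pos v + 1 < P.len (P.comp v) ∧ F (P.comp v) (P.pos v + 1) = c then 1 else 0 := by
    split_ifs with h
    · obtain ⟨w, hw, hwp⟩ := P.exists_pos v (P.pos v + 1) h.1
      rw [Set.ncard_eq_one]
      refine ⟨w, Set.eq_singleton_iff_unique_mem.2 ⟨⟨hw, hwp, h.2⟩, fun z hz => ?_⟩⟩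
      exact P.pos_inj _ _ (hz.1.trans hw.symm) (hz.2.1.trans hwp.symm)
    · rw [Set.ncard_eq_zero]
      refine Set.eq_empty_iff_forall_notMem.2 fun w hw => h ⟨?_, hw.2.2⟩
      rw [← hw.2.1, ← hw.1]
      exact P.pos_lt w
  have c₄ : S₄.ncard = if v ∈ U ∧ κ v = c then 1 else 0 := by
    split_ifs with h
    · rw [Set.ncard_eq_one]
      exact ⟨P.par v, Set.eq_singleton_iff_unique_mem.2
        ⟨⟨h.1, rfl, h.2⟩, fun z hz => hz.2.1.symm⟩⟩
    · rw [Set.ncard_eq_zero]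
      exact Set.eq_empty_iff_forall_notMem.2 fun w hw => h ⟨hw.1, hw.2.2⟩
  have hunion : {w | G.Adj v w ∧ P.edgeColoring U F κ v w = some c} = S₁ ∪ S₂ ∪ S₃ ∪ S₄ := by
    ext w
    simp only [Set.mem_union]
    constructor
    · rintro ⟨hadj, hf⟩
      unfold edgeColoring at hf
      split_ifs at hf with hl h1 h2
      · have hf' := Option.some.inj hf
        obtain ⟨hc, hp | hp⟩ := (P.adj_iff v w).1 ⟨hadj, hl⟩
        · rw [← hp, max_eq_right (Nat.le_succ _)] at hf'
          exact Or.inl (Or.inl (Or.inr ⟨hc.symm, hp.symm, hf'⟩))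
        · rw [← hp, max_eq_left (Nat.le_succ _), Nat.succ_eq_add_one, hp] at hf'
          exact Or.inl (Or.inl (Or.inl ⟨hc.symm, hp, hf'⟩))
      · exact Or.inr ⟨h1.1, h1.2, Option.some.inj hf⟩
      · exact Or.inl (Or.inr ⟨h2.1, h2.2, Option.some.inj hf⟩)
    · rintro (((hw | hw) | hw) | hw)
      · obtain ⟨hadj, hl⟩ := (P.adj_iff v w).2 ⟨hw.1.symm, Or.inr hw.2.1⟩
        refine ⟨hadj, ?_⟩
        rw [edgeColoring, if_pos hl, max_eq_left (by have := hw.2.1; omega), hw.2.2]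
      · obtain ⟨hadj, hl⟩ := (P.adj_iff v w).2 ⟨hw.1.symm, Or.inl hw.2.1.symm⟩
        refine ⟨hadj, ?_⟩
        rw [edgeColoring, if_pos hl, max_eq_right (by have := hw.2.1; omega), hw.2.1, hw.2.2]
      · have hadj := (hU.par_adj hw.1).1
        have hl := l₃ w hw
        rw [hw.2.1] at hadj
        refine ⟨hadj.symm, ?_⟩
        rw [hU.edgeColoring_comm F κ hadj.symm, edgeColoring, if_neg (by omega),
          if_pos ⟨hw.1, hw.2.1⟩, hw.2.2]
      · have hadj := (hU.par_adj hw.1).1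
        have hl := l₄ w hw
        rw [hw.2.1] at hadj
        refine ⟨hadj, ?_⟩
        rw [edgeColoring, if_neg (by omega), if_pos ⟨hw.1, hw.2.1⟩, hw.2.2]
  have d₁₂ : Disjoint S₁ S₂ := Set.disjoint_left.2 fun w h h' => by
    have := h.2.1
    have := h'.2.1
    omega
  have d₃ : Disjoint (S₁ ∪ S₂) S₃ := Set.disjoint_left.2 fun w h h' => by
    have := l₃ w h'
    rcases h with h | h
    · have := l₁ w h; omega
    · have := l₂ w h; omega
  have d₄ : Disjoint (S₁ ∪ S₂ ∪ S₃) S₄ := Set.disjoint_left.2 fun w h h' => by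
    have := l₄ w h'
    rcases h with (h | h) | h
    · have := l₁ w h; omega
    · have := l₂ w h; omega
    · have := l₃ w h; omega
  rw [hunion, Set.ncard_union_eq d₄, Set.ncard_union_eq d₃, Set.ncard_union_eq d₁₂, c₁, c₂, c₄]
  rfl

theorem tlirColorable [Finite V] (P : G.PathLayering ι) : G.TLIRColorable 3 := by
  classical
  obtain ⟨U, hU⟩ := P.exists_isHeadSet
  obtain ⟨E, X, hX, hE⟩ := hU.exists_path_colorings
  obtain ⟨κ, hκ⟩ := exists_item_coloring hX
  -- A bad path continues the color of its recolored edge: that edge and the first path edge form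
  -- the first monochromatic pair. The chosen head is unique, being at position 0.
  let F : ι → ℕ → Bool := fun i => if h : P.IsBad U i then pairColor (κ h.choose) else E i
  have hFU : ∀ u ∈ U, F (P.comp u) = pairColor (κ u) := by
    intro u hu
    have h : P.IsBad U (P.comp u) := ⟨u, hu, rfl⟩
    have he : h.choose = u := P.pos_inj _ _ h.choose_spec.2
      (((hU _).1 h.choose_spec.1).1.trans ((hU u).1 hu).1.symm)
    simp only [F, dif_pos h, he]
  have hFE : ∀ i, ¬ P.IsBad U i → F i = E i := fun i h => dif_neg h
  let Z : V → Bool → ℕ := fun v c =>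
    pathDegree (P.len (P.comp v)) (F (P.comp v)) (P.pos v) c + X v c
  -- A head has two edges of color `κ u`. Its own color raises the degree to 3 exactly when the
  -- parent has degree 2.
  let η : V → Bool := fun u => if Z (P.par u) (κ u) = 2 then κ u else !κ u
  let g : V → Option Bool := fun v =>
    if v ∈ U then some (η v) else if P.IsPlain U v then none else some (κ v)
  have main : G.TLIRColorable (Fintype.card (Option Bool)) := by
    refine .of_symm_coloring (P.edgeColoring U F κ) g (fun u v h => hU.edgeColoring_comm F κ h) ?_
    intro d hd
    -- At a head, the removed edge to the parent flips the odd parity to even, so the head must not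
    -- be colored `none`. Elsewhere `IsPlain` makes the correction.
    have hnone : ∀ v, Even (d none v + P.level v) := by
      intro v
      have h := hd none v
      rw [edgeColoring_eq_none] at h
      by_cases hvU : v ∈ U
      · have hg : g v ≠ none := by simp [g, hvU]
        obtain ⟨hpar, hodd⟩ := hU.of_isBad ⟨v, hvU, rfl⟩
        obtain ⟨hadj, hl⟩ := hU.par_adj hvU
        have hmem : P.par v ∈ P.cross v := ⟨hadj, by omega⟩
        have heq : P.plainCross U v = P.cross v \ {P.par v} := by
          ext x
          simp only [plainCross, cross, Set.mem_ofPred_eq, Set.mem_sdiff, Set.mem_singleton_iff]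
          have := hpar x
          constructor
          · rintro ⟨h1, h2, h3, -⟩
            exact ⟨⟨h1, h2⟩, fun e => h3 ⟨hvU, e.symm⟩⟩
          · rintro ⟨⟨h1, h2⟩, h3⟩
            exact ⟨h1, h2, fun e => h3 e.2.symm, fun e => this e.1 e.2⟩
        have hc := Set.ncard_sdiff_singleton_add_one hmem
        rw [← heq] at hc
        rcases h with ⟨h, -⟩ | ⟨-, h⟩
        · rw [← h]
          rw [← hc] at hodd
          grind
        · exact absurd h hg
      · by_cases hp : P.IsPlain U v
        · have hg : g v = none := by simp [g, hvU, hp]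
          rcases h with ⟨-, h⟩ | ⟨h, -⟩
          · exact absurd hg h
          · rw [← h]
            unfold IsPlain at hp
            grind
        · have hg : g v ≠ none := by simp [g, hvU, hp]
          rcases h with ⟨h, -⟩ | ⟨-, h⟩
          · rw [← h]
            exact Nat.not_odd_iff_even.1 hp
          · exact absurd h hg
    -- The items were defined so that they account for recolored edges from below and for the color
    -- of the vertex itself.
    have hgood : ∀ v c, ¬ P.IsBad U (P.comp v) → d (some c) v = Z v c := by
      intro v c hv
      have hvU : v ∉ U := fun h => hv ⟨v, h, rfl⟩
      have h := hd (some c) v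
      rw [hU.ncard_edgeColoring_eq_some, if_neg (fun h => hvU h.1), add_zero] at h
      simp only [Z, ← hκ v c]
      by_cases hg : g v = some c
      · have hvp : ¬ P.IsPlain U v ∧ κ v = c := by
          by_cases hp : P.IsPlain U v <;> simp_all [g]
        have heq : {w | w ∈ P.items U v ∧ κ w = c} =
            insert v {w | w ∈ U ∧ P.par w = v ∧ κ w = c} := by
          ext w
          simp only [items, Set.mem_ofPred_eq, Set.mem_insert_iff]
          by_cases hw : w ∈ U
          · have hne : w ≠ v := fun e => hvU (e ▸ hw)
            simp [hw, hne]
          · simp only [hw, if_false, false_or, false_and, or_false]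
            exact ⟨fun h => h.1.1, fun h => by subst h; exact ⟨⟨rfl, hvp.1⟩, hvp.2⟩⟩
        rw [heq, Set.ncard_insert_of_notMem (fun h => hvU h.1)]
        rcases h with ⟨-, h⟩ | ⟨h, -⟩
        · exact absurd hg h
        · omega
      · have heq : {w | w ∈ P.items U v ∧ κ w = c} = {w | w ∈ U ∧ P.par w = v ∧ κ w = c} := by
          ext w
          simp only [items, Set.mem_ofPred_eq]
          by_cases hw : w ∈ U
          · simp [hw]
          · simp only [hw, if_false, false_or, false_and, iff_false]
            rintro ⟨⟨rfl, h1⟩, h2⟩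
            exact hg (by simp [g, hw, h1, h2])
        rw [heq]
        rcases h with ⟨h, -⟩ | ⟨-, h⟩
        · exact h.symm
        · exact absurd h hg
    have hpend : ∀ v c, P.IsBad U (P.comp v) →
        {w | w ∈ U ∧ P.par w = v ∧ κ w = c}.ncard = 0 := by
      intro v c hv
      rw [Set.ncard_eq_zero]
      exact Set.eq_empty_iff_forall_notMem.2 fun w hw => (hU.of_isBad hv).1 w hw.1 hw.2.1
    have hbad : ∀ v c, P.IsBad U (P.comp v) → v ∉ U →
        d (some c) v = pathDegree (P.len (P.comp v)) (F (P.comp v)) (P.pos v) c := by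
      intro v c hv hvU
      have h := hd (some c) v
      rw [hU.ncard_edgeColoring_eq_some, if_neg (fun h => hvU h.1), hpend v c hv] at h
      have hp : P.IsPlain U v := by
        unfold IsPlain
        rw [plainCross_eq_cross hvU (hU.of_isBad hv).1]
        exact (hU.of_isBad hv).2
      have hg : g v ≠ some c := by simp [g, hvU, hp]
      rcases h with ⟨h, -⟩ | ⟨-, h⟩
      · exact h.symm
      · exact absurd h hg
    have hhead : ∀ u ∈ U, d (some (κ u)) u = 2 + if Z (P.par u) (κ u) = 2 then 1 else 0 := by
      intro u hu
      have h := hd (some (κ u)) u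
      rw [hU.ncard_edgeColoring_eq_some, if_pos ⟨hu, rfl⟩, hpend u _ ⟨u, hu, rfl⟩, hFU u hu,
        ((hU u).1 hu).1, pathDegree_pairColor_zero (hU.one_lt_len hu)] at h
      have hg : g u = some (κ u) ↔ Z (P.par u) (κ u) = 2 := by
        simp only [g, hu, if_true, η, Option.some.injEq]
        split_ifs with h2 <;> simp [h2]
      rcases h with ⟨h, hne⟩ | ⟨h, he⟩
      · rw [if_neg (fun e => hne (hg.2 e))]; omega
      · rw [if_pos (hg.1 he)]; omega
    have hpath : ∀ u v, P.comp u = P.comp v → P.pos u + 1 = P.pos v →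
        d (some (F (P.comp v) (P.pos v))) u ≠ d (some (F (P.comp v) (P.pos v))) v := by
      intro u v huv hpos
      by_cases hv : P.IsBad U (P.comp v)
      · have hvU : v ∉ U := fun h => by
          have := ((hU v).1 h).1
          omega
        obtain ⟨w, hw, hwv⟩ := id hv
        have hlt := P.pos_lt v
        have hw0 := (hU w).1 hw
        have hF : F (P.comp v) = pairColor (κ w) := by rw [← hwv, hFU w hw]
        -- Next to the head, degree 2 or 3 meets degree 1. Farther along, the head's own color has
        -- no influence.
        by_cases h0 : P.pos u = 0
        · obtain rfl : u = w := P.pos_inj _ _ (huv.trans hwv.symm) (h0.trans hw0.1.symm)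
          have hv1 : P.pos v = 1 := by omega
          have hc : F (P.comp v) (P.pos v) = κ u := by rw [hF, hv1]; simp [pairColor]
          rw [hc, hhead u hw, hbad v _ hv hvU, hF, hv1, pathDegree_pairColor_one]
          omega
        · have huU : u ∉ U := fun h => h0 ((hU u).1 h).1
          rw [hbad v _ hv hvU, hbad u _ (huv ▸ hv) huU, huv, hF, ← hpos]
          exact pathDegree_pairColor (hwv ▸ hw0.2.1) _ (by omega) (by omega)
      · rw [hgood v _ hv, hgood u _ (huv ▸ hv)]
        simp only [Z, huv, hFE _ hv]
        exact hE u v huv hv hpos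
    have hup : ∀ u ∈ U, d (some (κ u)) u ≠ d (some (κ u)) (P.par u) := by
      intro u hu
      -- The parent's path has received a recolored edge, so it is not bad and its degrees are the
      -- prescribed values `Z`.
      have hn : ¬ P.IsBad U (P.comp (P.par u)) := fun h => (hU.of_isBad h).1 u hu rfl
      rw [hhead u hu, hgood _ _ hn]
      split_ifs with h <;> omega
    intro u v huv
    by_cases hl : P.level u = P.level v
    · have hf : P.edgeColoring U F κ u v = some (F (P.comp u) (max (P.pos u) (P.pos v))) :=
        if_pos hl
      obtain ⟨hc, hp | hp⟩ := (P.adj_iff u v).1 ⟨huv, hl⟩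
      · rw [hf, max_eq_right (by omega), hc]
        exact hpath u v hc hp
      · rw [hf, max_eq_left (by omega)]
        exact (hpath v u hc.symm hp).symm
    · by_cases h1 : u ∈ U ∧ P.par u = v
      · have hf : P.edgeColoring U F κ u v = some (κ u) := by
          rw [edgeColoring, if_neg hl, if_pos h1]
        rw [hf, ← h1.2]
        exact hup u h1.1
      · by_cases h2 : v ∈ U ∧ P.par v = u
        · have hf : P.edgeColoring U F κ u v = some (κ v) := by
            rw [edgeColoring, if_neg hl, if_neg h1, if_pos h2]
          rw [hf, ← h2.2]
          exact (hup v h2.1).symm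
        · have hf : P.edgeColoring U F κ u v = none := by
            rw [edgeColoring, if_neg hl, if_neg h1, if_neg h2]
          rw [hf]
          intro he
          have e1 := hnone u
          have e2 := hnone v
          have e3 := P.odd_of_adj u v huv hl
          rw [he] at e1
          grind
  simpa using main

end PathLayering

end SimpleGraph

theorem mainTheorem7 {V : Type*} [Finite V] (G : SimpleGraph V) (hG : G.IsOuterplanar) :
    G.tlir ≤ 3 := by
  obtain ⟨P⟩ := hG.exists_pathLayering
  exact iInf₂_le 3 P.tlirColorable
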